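/- **Setting.** Fix $p\in[1,\infty]$. For finite sets $A,B\subset\mathbb R^2$, a *$k$-matching* is a set $M\subseteq A\times B$ of $k$ pairs such that every point of $A$ and every point of $B$ occurs in at most one pair. For a translation vector $t\in\mathbb R^2$ its cost is $$\mathrm{cost}_p(M,t)=\Big[\tfrac1k\sum_{(a,b)\in M}\|a+t-b\|^p\Big]^{1/p}\quad(p<\infty),\qquad \mathrm{cost}_\infty(M,t)=\max_{(a,b)\in M}\|a+t-b\|,$$ with the Euclidean norm, and $\mathrm{opt}(t)=\min_M\mathrm{cost}_p(M,t)$, the minimum being over all $k$-matchings between $A$ and $B$. The model of computation is a real RAM with unit-cost operations: integer memory with addition, subtraction, comparison and indirect addressing; real memory with $+,-,\cdot,/$, comparison, square roots, and $p$-th powers and $p$-th roots for the fixed $p$ (no rounding of reals to integers). The algorithm may call a deterministic black box which, given two (stationary) sets of $m$ and $n$ points of the plane in memory, an integer $1\le k\le\min\{m,n\}$ and a real $0<\delta\le1$, returns a $k$-matching between them whose cost (without translation) is at most $1+\delta$ times the minimum. One such call takes time $W(m,n,k,\delta)$; this includes the time for reading the $m+n$ points, so $W(m,n,k,\delta)\ge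 m+n$, and is otherwise arbitrary. **Theorem.** For every $p\in[1,\infty]$ there are a (deterministic) program for this machine and constants $C$, $c$, depending only on $p$, such that the following holds for every such black box. Let $A,B\subset\mathbb R^2$ with $|A|=m$ and $|B|=n$, and let $0<\varepsilon\le1$ and $1\le k\le\min\{m,n\}$. Then $\mathrm{opt}$ attains its minimum over $\mathbb R^2$ at some $t^*$, and on input $A$, $B$ (listed in any order), $k$, $\varepsilon$ the program computes a translation vector $\tilde t\in\mathbb R^2$ and a $k$-matching $\widetilde M$ between $A$ and $B$ with $$\mathrm{cost}_p(\widetilde M,\tilde t)\le(1+\varepsilon)\,\mathrm{opt}(t^*)=(1+\varepsilon)\min_{t}\mathrm{opt}(t)$$ in time at most $$C\Big(mn+\frac{mn}{\varepsilon^2k}\,W\big(m,n,k,\tfrac\varepsilon2\big)\Big)\Big(1+\log\frac{mn}{\varepsilon}\Big)^{c},$$ that is, in time $\widetilde O\big(mn+\frac{mn}{\varepsilon^2k}W(m,n,k,\frac\varepsilon2)\big)$, where $\widetilde O$ hides polylogarithmic factors in $m$, $n$ and $1/\varepsilon$. -/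

import Mathlib

open scoped ENNReal NNReal

/-! ## Matchings between planar point sets, and their costs -/

/-- The plane `ℝ²` with the Euclidean norm. -/
abbrev Plane : Type := EuclideanSpace ℝ (Fin 2)

/-- `M` is a `k`-matching between `A` and `B`: a set of `k` pairs in `A × B` such that every point of
`A` and every point of `B` occurs in at most one pair. -/
def IsKMatching (A B : Finset Plane) (k : ℕ) (M : Finset (Plane × Plane)) : Prop :=
  M ⊆ A ×ˢ B ∧ M.card = k ∧
    Set.InjOn Prod.fst (M : Set (Plane × Plane)) ∧ Set.InjOn Prod.snd (M : Set (Plane × Plane))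

open scoped Classical in
/-- The `L_p`-cost of a matching `M` under the translation `t`, normalized by the size of `M`. -/
noncomputable def matchCost (p : ℝ≥0∞) (M : Finset (Plane × Plane)) (t : Plane) : ℝ :=
  if p = ∞ then
    ((M.sup fun e => ‖e.1 + t - e.2‖₊ : ℝ≥0) : ℝ)
  else
    ((1 / (M.card : ℝ)) * ∑ e ∈ M, ‖e.1 + t - e.2‖ ^ p.toReal) ^ (1 / p.toReal)

/-- The smallest cost of a `k`-matching between `A + t` and `B`. -/
noncomputable def optCost (p : ℝ≥0∞) (A B : Finset Plane) (k : ℕ) (t : Plane) : ℝ :=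
  ⨅ M : {M : Finset (Plane × Plane) // IsKMatching A B k M}, matchCost p M.1 t

open scoped Classical in
/-- The set of the points that are listed by an array. -/
noncomputable def pointSet {m : ℕ} (a : Fin m → Plane) : Finset Plane :=
  Finset.univ.image a

open scoped Classical in
/-- The index pairs `f 0, …, f (k - 1)` list the matching `M` between the points in the arrays `a`
and `b`. In particular all these indices are in range. -/
def Encodes {m n : ℕ} (a : Fin m → Plane) (b : Fin n → Plane) (k : ℕ) (f : ℕ → ℕ × ℕ)
    (M : Finset (Plane × Plane)) : Prop :=
  ∃ (i : Fin k → Fin m) (j : Fin k → Fin n),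
    (∀ l : Fin k, f l = ((i l : ℕ), (j l : ℕ))) ∧
      M = Finset.univ.image fun l => (a (i l), b (j l))

/-! ## Black boxes for stationary point sets -/

/-- A deterministic black box that computes `(1 + δ)`-approximate minimum-cost `k`-matchings between
two stationary sets of `m` and `n` points, for every `0 < δ ≤ 1` and `1 ≤ k ≤ min m n`.
The answer is a list of `k` index pairs. Nothing is known about its answers to other queries. The
number `work m n k δ` bounds the time it spends on a query after reading the `m + n` points. -/
structure StationarySolver (p : ℝ≥0∞) where
  solve : {m n : ℕ} → (Fin m → Plane) → (Fin n → Plane) → ℕ → ℝ → ℕ → ℕ × ℕ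
  work : ℕ → ℕ → ℕ → ℝ → ℕ
  correct : ∀ {m n : ℕ} (a : Fin m → Plane) (b : Fin n → Plane) (k : ℕ) (δ : ℝ),
    Function.Injective a → Function.Injective b → 1 ≤ k → k ≤ min m n → 0 < δ → δ ≤ 1 →
    ∃ M : Finset (Plane × Plane), Encodes a b k (solve a b k δ) M ∧
      IsKMatching (pointSet a) (pointSet b) k M ∧
      matchCost p M 0 ≤ (1 + δ) * optCost p (pointSet a) (pointSet b) k 0

/-- The time `W(m, n, k, δ)` of a query, which includes the time for reading the `m + n` points. -/
def StationarySolver.W {p : ℝ≥0∞} (O : StationarySolver p) (m n k : ℕ) (δ : ℝ) : ℕ :=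
  m + n + O.work m n k δ

/-! ## The real RAM

The memory consists of integer arrays and real arrays, which are named and indexed by natural
numbers. A program names only finitely many arrays. Indices are computed at run time (indirect
addressing). Every single operation takes one unit of time. There is no rounding of reals to
integers, and integers can only be added, subtracted and compared. -/

namespace RealRAM

structure State where
  int : ℕ → ℕ → ℕ
  real : ℕ → ℕ → ℝ

/-- Integer expressions. -/
inductive IExp : Type
  | const (c : ℕ)
  | read (arr : ℕ) (idx : IExp)
  | add (e f : IExp)
  | sub (e f : IExp)

/-- Subtraction of integers is truncated at `0`. -/
def IExp.eval (s : State) : IExp → ℕ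
  | .const c => c
  | .read arr idx => s.int arr (idx.eval s)
  | .add e f => e.eval s + f.eval s
  | .sub e f => e.eval s - f.eval s

/-- The number of operations in the evaluation of an expression. -/
def IExp.size : IExp → ℕ
  | .const _ => 1
  | .read _ idx => idx.size + 1
  | .add e f => e.size + f.size + 1
  | .sub e f => e.size + f.size + 1

/-- Real expressions. Only rational constants are available. Besides the four basic operations there
are square roots, `p`-th powers and `p`-th roots, where `p` is the fixed parameter of the cost. -/
inductive RExp : Type
  | const (q : ℚ)
  | read (arr : ℕ) (idx : IExp)
  | ofInt (e : IExp)
  | add (e f : RExp)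
  | sub (e f : RExp)
  | mul (e f : RExp)
  | div (e f : RExp)
  | sqrt (e : RExp)
  | pow (e : RExp)
  | root (e : RExp)

/-- Division by `0` and square roots of negative numbers give `0`; powers and roots are taken of the
absolute value. -/
noncomputable def RExp.eval (p : ℝ≥0∞) (s : State) : RExp → ℝ
  | .const q => (q : ℝ)
  | .read arr idx => s.real arr (idx.eval s)
  | .ofInt e => (e.eval s : ℝ)
  | .add e f => e.eval p s + f.eval p s
  | .sub e f => e.eval p s - f.eval p s
  | .mul e f => e.eval p s * f.eval p s
  | .div e f => e.eval p s / f.eval p s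
  | .sqrt e => Real.sqrt (e.eval p s)
  | .pow e => |e.eval p s| ^ p.toReal
  | .root e => |e.eval p s| ^ (1 / p.toReal)

/-- The number of operations in the evaluation of an expression. -/
def RExp.size : RExp → ℕ
  | .const _ => 1
  | .read _ idx => idx.size + 1
  | .ofInt e => e.size + 1
  | .add e f => e.size + f.size + 1
  | .sub e f => e.size + f.size + 1
  | .mul e f => e.size + f.size + 1
  | .div e f => e.size + f.size + 1
  | .sqrt e => e.size + 1
  | .pow e => e.size + 1
  | .root e => e.size + 1

/-- Tests: comparisons of integers, comparisons of reals, and Boolean combinations. -/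
inductive Test : Type
  | ltInt (e f : IExp)
  | ltReal (e f : RExp)
  | neg (b : Test)
  | conj (b c : Test)

def Test.Holds (p : ℝ≥0∞) (s : State) : Test → Prop
  | .ltInt e f => e.eval s < f.eval s
  | .ltReal e f => e.eval p s < f.eval p s
  | .neg b => ¬ b.Holds p s
  | .conj b c => b.Holds p s ∧ c.Holds p s

def Test.size : Test → ℕ
  | .ltInt e f => e.size + f.size + 1
  | .ltReal e f => e.size + f.size + 1
  | .neg b => b.size + 1
  | .conj b c => b.size + c.size + 1

/-- Programs. `query ax ay bx yb m n k δ oi oj` asks the black box for a `(1 + δ)`-approximate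
`k`-matching between the `m` points with coordinates in the real arrays `ax`, `ay` and the `n` points
with coordinates in the real arrays `bx`, `yb`; the index pairs of the answer are written to the
integer arrays `oi` and `oj`. -/
inductive Program : Type
  | skip
  | setInt (arr : ℕ) (idx : IExp) (e : IExp)
  | setReal (arr : ℕ) (idx : IExp) (e : RExp)
  | seq (P Q : Program)
  | ite (b : Test) (P Q : Program)
  | while (b : Test) (P : Program)
  | query (ax ay bx yb : ℕ) (m n k : IExp) (δ : RExp) (oi oj : ℕ)

def State.writeInt (s : State) (arr idx v : ℕ) : State :=
  { s with int := fun r l => if r = arr ∧ l = idx then v else s.int r l }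

def State.writeReal (s : State) (arr idx : ℕ) (v : ℝ) : State :=
  { s with real := fun r l => if r = arr ∧ l = idx then v else s.real r l }

/-- Write the pairs `f 0, …, f (k - 1)` to the integer arrays `oi` and `oj`. -/
def State.writePairs (s : State) (oi oj k : ℕ) (f : ℕ → ℕ × ℕ) : State :=
  { s with
    int := fun r l =>
      if r = oi ∧ l < k then (f l).1 else if r = oj ∧ l < k then (f l).2 else s.int r l }

/-- The first `m` points whose coordinates are stored in the real arrays `ax` and `ay`. -/
noncomputable def State.points (s : State) (ax ay m : ℕ) : Fin m → Plane :=
  fun i => !₂[s.real ax i, s.real ay i]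

/-- `Exec O P s s' T`: with the black box `O`, the program `P`, started in state `s`, halts in state
`s'` after time `T`. -/
inductive Exec {p : ℝ≥0∞} (O : StationarySolver p) : Program → State → State → ℕ → Prop
  | skip (s : State) : Exec O .skip s s 1
  | setInt (s : State) (arr : ℕ) (idx e : IExp) :
      Exec O (.setInt arr idx e) s (s.writeInt arr (idx.eval s) (e.eval s)) (idx.size + e.size + 1)
  | setReal (s : State) (arr : ℕ) (idx : IExp) (e : RExp) :
      Exec O (.setReal arr idx e) s (s.writeReal arr (idx.eval s) (e.eval p s))
        (idx.size + e.size + 1)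
  | seq {P Q : Program} {s s' s'' : State} {T T' : ℕ} :
      Exec O P s s' T → Exec O Q s' s'' T' → Exec O (.seq P Q) s s'' (T + T')
  | iteTrue {b : Test} {P Q : Program} {s s' : State} {T : ℕ} :
      b.Holds p s → Exec O P s s' T → Exec O (.ite b P Q) s s' (b.size + T)
  | iteFalse {b : Test} {P Q : Program} {s s' : State} {T : ℕ} :
      ¬ b.Holds p s → Exec O Q s s' T → Exec O (.ite b P Q) s s' (b.size + T)
  | whileTrue {b : Test} {P : Program} {s s' s'' : State} {T T' : ℕ} :
      b.Holds p s → Exec O P s s' T → Exec O (.while b P) s' s'' T' →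
      Exec O (.while b P) s s'' (b.size + T + T')
  | whileFalse {b : Test} {P : Program} {s : State} :
      ¬ b.Holds p s → Exec O (.while b P) s s b.size
  | query (s : State) (ax ay bx yb : ℕ) (m n k : IExp) (δ : RExp) (oi oj : ℕ) :
      Exec O (.query ax ay bx yb m n k δ oi oj) s
        (s.writePairs oi oj (k.eval s)
          (O.solve (s.points ax ay (m.eval s)) (s.points bx yb (n.eval s)) (k.eval s) (δ.eval p s)))
        (m.size + n.size + k.size + δ.size + 1
          + O.W (m.eval s) (n.eval s) (k.eval s) (δ.eval p s))

/-- The machine is deterministic: final state and running time are determined by the start. -/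
theorem Exec.deterministic {p : ℝ≥0∞} {O : StationarySolver p} {P : Program} {s s₁ s₂ : State}
    {T₁ T₂ : ℕ} (h₁ : Exec O P s s₁ T₁) (h₂ : Exec O P s s₂ T₂) : s₁ = s₂ ∧ T₁ = T₂ := by
  induction h₁ generalizing s₂ T₂ with
  | skip s => cases h₂; exact ⟨rfl, rfl⟩
  | setInt s arr idx e => cases h₂; exact ⟨rfl, rfl⟩
  | setReal s arr idx e => cases h₂; exact ⟨rfl, rfl⟩
  | seq _ _ ih ih' =>
    cases h₂ with
    | seq h h' =>
      obtain ⟨rfl, rfl⟩ := ih h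
      obtain ⟨rfl, rfl⟩ := ih' h'
      exact ⟨rfl, rfl⟩
  | iteTrue hb _ ih =>
    cases h₂ with
    | iteTrue _ h => obtain ⟨rfl, rfl⟩ := ih h; exact ⟨rfl, rfl⟩
    | iteFalse hb' _ => exact absurd hb hb'
  | iteFalse hb _ ih =>
    cases h₂ with
    | iteTrue hb' _ => exact absurd hb' hb
    | iteFalse _ h => obtain ⟨rfl, rfl⟩ := ih h; exact ⟨rfl, rfl⟩
  | whileTrue hb _ _ ih ih' =>
    cases h₂ with
    | whileTrue _ h h' =>
      obtain ⟨rfl, rfl⟩ := ih h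
      obtain ⟨rfl, rfl⟩ := ih' h'
      exact ⟨rfl, rfl⟩
    | whileFalse hb' => exact absurd hb hb'
  | whileFalse hb =>
    cases h₂ with
    | whileTrue hb' _ _ => exact absurd hb' hb
    | whileFalse _ => exact ⟨rfl, rfl⟩
  | query s ax ay bx yb m n k δ oi oj => cases h₂; exact ⟨rfl, rfl⟩

/-- The initial state for the point sets in the arrays `a`, `b` and for the parameters `k`, `ε`.
Integer array `0` holds `m`, `n`, `k`; real arrays `0`, `1` hold the coordinates of the points of
`a`, real arrays `2`, `3` those of `b`, and real array `4` holds `ε`. The rest of the memory is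
zero. -/
noncomputable def input {m n : ℕ} (a : Fin m → Plane) (b : Fin n → Plane) (k : ℕ) (ε : ℝ) :
    State where
  int := fun r l =>
    if r = 0 then (if l = 0 then m else if l = 1 then n else if l = 2 then k else 0) else 0
  real := fun r l =>
    if r = 0 then (if h : l < m then a ⟨l, h⟩ 0 else 0)
    else if r = 1 then (if h : l < m then a ⟨l, h⟩ 1 else 0)
    else if r = 2 then (if h : l < n then b ⟨l, h⟩ 0 else 0)
    else if r = 3 then (if h : l < n then b ⟨l, h⟩ 1 else 0)
    else if r = 4 ∧ l = 0 then ε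
    else 0

/-- The translation vector in a final state: the first two entries of real array `5`. -/
noncomputable def State.outVector (s : State) : Plane := !₂[s.real 5 0, s.real 5 1]

/-- The list of index pairs in a final state: the entries of the integer arrays `1` and `2`. -/
def State.outPairs (s : State) : ℕ → ℕ × ℕ := fun l => (s.int 1 l, s.int 2 l)

end RealRAM

/-!
Let `r` be the cost of an optimal matching at an optimal translation `t`, which exists because the
cost of a matching is a coercive `1`-Lipschitz function of the translation
(`exists_forall_optCost_le`). By Markov's inequality at least `k / 2` of the `N = m n` difference
vectors `b - a` lie within distance `2 r` of `t` (`exists_short_pairs`), hence in a square of half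
side `2 r` around `t`. A set of `(N / k)` times polylogarithmically many difference vectors that meets
every axis-parallel box with at least `k / 2` differences is obtained from merge sort. The differences
are sorted by their first coordinates, and then by their second coordinates, and all levels of the
second sort are kept. A box selects an interval of positions by its first coordinates, and this
interval is a union of `O(log N)` dyadic blocks; one of them contains many differences of the box
(`exists_dyadic_of_lt_countP`). In the copy of this block that is sorted by the second coordinate they
are consecutive. So it suffices to take every `σ`-th position of the whole memory, where `σ` is about
`k / log N` (`exists_mem_box`). These are the candidates, and they do not depend on `r`.

The best answer of the black box over all candidates has a cost `ρ` with `r ≤ ρ ≤ 15 r / 2`, because one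
candidate has coordinates within `2 r` of those of `t`. Around every candidate the square of
half side `2 ρ` is then searched by a grid of mesh width `ε ρ / 72`, with `O(1 / ε ^ 2)` translations.
One of them is close enough to `t` for the approximation ratio `(1 + ε / 2) (1 + 5 ε / 24) ≤ 1 + ε`. The
search of the candidates alone is the same program, with `ρ = 0`.

Programs are verified with a predicate `Runs` on the final state and the running time. Loop-free code
is executed by rewriting, and `runs_while` handles loops with a known number of iterations. A predicate
`Frame` lists the arrays that a program may change.
-/

/-! ### Rules for the execution of programs -/

namespace RealRAM

/-- `Runs O P s Q`: the program `P`, started in `s`, halts, and the final state and the running time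
satisfy `Q`. -/
def Runs {p : ℝ≥0∞} (O : StationarySolver p) (P : Program) (s : State) (Q : State → ℕ → Prop) :
    Prop :=
  ∃ s' T, Exec O P s s' T ∧ Q s' T

section Rules

variable {p : ℝ≥0∞} {O : StationarySolver p}

theorem Runs.mono {P : Program} {s : State} {Q R : State → ℕ → Prop} (h : Runs O P s Q)
    (hQR : ∀ s' T, Q s' T → R s' T) : Runs O P s R := by
  obtain ⟨s', T, hE, hQ⟩ := h
  exact ⟨s', T, hE, hQR _ _ hQ⟩

theorem runs_skip {s : State} {Q : State → ℕ → Prop} : Runs O .skip s Q ↔ Q s 1 := by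
  constructor
  · rintro ⟨s', T, h, hQ⟩; cases h; exact hQ
  · exact fun h => ⟨_, _, .skip s, h⟩

theorem runs_setInt {s : State} {arr : ℕ} {idx e : IExp} {Q : State → ℕ → Prop} :
    Runs O (.setInt arr idx e) s Q ↔
      Q (s.writeInt arr (idx.eval s) (e.eval s)) (idx.size + e.size + 1) := by
  constructor
  · rintro ⟨s', T, h, hQ⟩; cases h; exact hQ
  · exact fun h => ⟨_, _, .setInt s arr idx e, h⟩

theorem runs_setReal {s : State} {arr : ℕ} {idx : IExp} {e : RExp} {Q : State → ℕ → Prop} :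
    Runs O (.setReal arr idx e) s Q ↔
      Q (s.writeReal arr (idx.eval s) (e.eval p s)) (idx.size + e.size + 1) := by
  constructor
  · rintro ⟨s', T, h, hQ⟩; cases h; exact hQ
  · exact fun h => ⟨_, _, .setReal s arr idx e, h⟩

theorem runs_query {s : State} {ax ay bx yb : ℕ} {m n k : IExp} {δ : RExp} {oi oj : ℕ}
    {Q : State → ℕ → Prop} :
    Runs O (.query ax ay bx yb m n k δ oi oj) s Q ↔
      Q (s.writePairs oi oj (k.eval s)
          (O.solve (s.points ax ay (m.eval s)) (s.points bx yb (n.eval s)) (k.eval s)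
            (δ.eval p s)))
        (m.size + n.size + k.size + δ.size + 1
          + O.W (m.eval s) (n.eval s) (k.eval s) (δ.eval p s)) := by
  constructor
  · rintro ⟨s', T, h, hQ⟩; cases h; exact hQ
  · exact fun h => ⟨_, _, .query s ax ay bx yb m n k δ oi oj, h⟩

theorem runs_seq {P₁ P₂ : Program} {s : State} {Q : State → ℕ → Prop} :
    Runs O (.seq P₁ P₂) s Q ↔
      Runs O P₁ s fun s' T => Runs O P₂ s' fun s'' T' => Q s'' (T + T') := by
  constructor
  · rintro ⟨s', T, h, hQ⟩
    cases h with
    | seq h₁ h₂ => exact ⟨_, _, h₁, _, _, h₂, hQ⟩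
  · rintro ⟨s', T, h₁, s'', T', h₂, hQ⟩
    exact ⟨_, _, .seq h₁ h₂, hQ⟩

theorem runs_ite {b : Test} {P₁ P₂ : Program} {s : State} {Q : State → ℕ → Prop} :
    Runs O (.ite b P₁ P₂) s Q ↔
      (b.Holds p s → Runs O P₁ s fun s' T => Q s' (b.size + T)) ∧
      (¬ b.Holds p s → Runs O P₂ s fun s' T => Q s' (b.size + T)) := by
  constructor
  · rintro ⟨s', T, h, hQ⟩
    cases h with
    | iteTrue hb h => exact ⟨fun _ => ⟨_, _, h, hQ⟩, fun hb' => absurd hb hb'⟩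
    | iteFalse hb h => exact ⟨fun hb' => absurd hb' hb, fun _ => ⟨_, _, h, hQ⟩⟩
  · rintro ⟨h₁, h₂⟩
    by_cases hb : b.Holds p s
    · obtain ⟨s', T, h, hQ⟩ := h₁ hb
      exact ⟨_, _, .iteTrue hb h, hQ⟩
    · obtain ⟨s', T, h, hQ⟩ := h₂ hb
      exact ⟨_, _, .iteFalse hb h, hQ⟩

/-- The rule for a loop whose number `N` of iterations is known: `I i` is the loop invariant after
`i` iterations, and every iteration takes time at most `B`. -/
theorem runs_while {b : Test} {P : Program} (N B : ℕ) (I : ℕ → State → Prop)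
    (hstep : ∀ i s, i < N → I i s →
      b.Holds p s ∧ Runs O P s fun s' T => T ≤ B ∧ I (i + 1) s')
    (hend : ∀ s, I N s → ¬ b.Holds p s) {s : State} (h0 : I 0 s) :
    Runs O (.while b P) s fun s' T => T ≤ N * (b.size + B) + b.size ∧ I N s' := by
  suffices H : ∀ d i s, i + d = N → I i s →
      Runs O (.while b P) s fun s' T => T ≤ d * (b.size + B) + b.size ∧ I N s' from
    H N 0 s (by simp) h0
  intro d
  induction d with
  | zero =>
    intro i s hi hI
    obtain rfl : i = N := by simpa using hi
    exact ⟨s, _, .whileFalse (hend s hI), by simp, hI⟩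
  | succ d ih =>
    intro i s hi hI
    obtain ⟨hb, s', T, hE, hT, hI'⟩ := hstep i s (by omega) hI
    obtain ⟨s'', T', hE', hT', hI''⟩ := ih (i + 1) s' (by omega) hI'
    refine ⟨s'', _, .whileTrue hb hE hE', ?_, hI''⟩
    rw [Nat.succ_mul]
    omega

theorem Runs.seq {P₁ P₂ : Program} {s : State} {R : State → Prop} {B₁ B₂ : ℕ}
    {Q : State → Prop} (h₁ : Runs O P₁ s fun s' T => T ≤ B₁ ∧ R s')
    (h₂ : ∀ s', R s' → Runs O P₂ s' fun s'' T => T ≤ B₂ ∧ Q s'') :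
    Runs O (.seq P₁ P₂) s fun s' T => T ≤ B₁ + B₂ ∧ Q s' := by
  rw [runs_seq]
  refine h₁.mono fun s' T ⟨hT, hR⟩ => (h₂ s' hR).mono fun s'' T' ⟨hT', hQ⟩ => ⟨?_, hQ⟩
  omega

theorem Runs.of_le {P : Program} {s : State} {Q : State → Prop} {B B' : ℕ}
    (h : Runs O P s fun s' T => T ≤ B ∧ Q s') (hB : B ≤ B') :
    Runs O P s fun s' T => T ≤ B' ∧ Q s' :=
  h.mono fun _ _ h => ⟨h.1.trans hB, h.2⟩

end Rules

section Memory

variable (s : State) (r l arr idx : ℕ)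

@[simp] theorem writeInt_real (v : ℕ) : (s.writeInt arr idx v).real = s.real := rfl

@[simp] theorem writeReal_int (v : ℝ) : (s.writeReal arr idx v).int = s.int := rfl

theorem writeInt_int_self (v : ℕ) :
    (s.writeInt arr idx v).int arr l = if l = idx then v else s.int arr l := by
  simp [State.writeInt]

theorem writeReal_real_self (v : ℝ) :
    (s.writeReal arr idx v).real arr l = if l = idx then v else s.real arr l := by
  simp [State.writeReal]

theorem writeInt_int_of_ne (v : ℕ) {arr r : ℕ} (h : r ≠ arr) :
    (s.writeInt arr idx v).int r = s.int r := by
  funext l; simp [State.writeInt, h]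

theorem writeReal_real_of_ne (v : ℝ) {arr r : ℕ} (h : r ≠ arr) :
    (s.writeReal arr idx v).real r = s.real r := by
  funext l; simp [State.writeReal, h]

theorem writePairs_int_of_ne (k : ℕ) (f : ℕ → ℕ × ℕ) {oi oj r : ℕ} (h : r ≠ oi) (h' : r ≠ oj) :
    (s.writePairs oi oj k f).int r = s.int r := by
  funext l; simp [State.writePairs, h, h']

end Memory

end RealRAM

/-! ### Costs of matchings as functions of the translation -/

theorem matchCost_top (M : Finset (Plane × Plane)) (t : Plane) :
    matchCost ∞ M t = ((M.sup fun e => ‖e.1 + t - e.2‖₊ : ℝ≥0) : ℝ) := by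
  simp [matchCost]

theorem matchCost_of_ne_top {p : ℝ≥0∞} (h : p ≠ ∞) (M : Finset (Plane × Plane)) (t : Plane) :
    matchCost p M t =
      ((1 / (M.card : ℝ)) * ∑ e ∈ M, ‖e.1 + t - e.2‖ ^ p.toReal) ^ (1 / p.toReal) := by
  simp [matchCost, h]

theorem matchCost_nonneg (p : ℝ≥0∞) (M : Finset (Plane × Plane)) (t : Plane) :
    0 ≤ matchCost p M t := by
  unfold matchCost
  split_ifs
  · exact NNReal.coe_nonneg _
  · positivity

theorem one_le_toReal {p : ℝ≥0∞} (hp : 1 ≤ p) (h : p ≠ ∞) : 1 ≤ p.toReal := by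
  have := (ENNReal.toReal_le_toReal ENNReal.one_ne_top h).2 hp
  simpa using this

/-- The cost of a fixed matching is a `1`-Lipschitz function of the translation; for `p < ∞` this is
Minkowski's inequality. -/
theorem matchCost_le_add {p : ℝ≥0∞} (hp : 1 ≤ p) (M : Finset (Plane × Plane)) (t u : Plane) :
    matchCost p M u ≤ matchCost p M t + ‖u - t‖ := by
  have tri : ∀ e : Plane × Plane, ‖e.1 + u - e.2‖ ≤ ‖e.1 + t - e.2‖ + ‖u - t‖ := fun e => by
    have : e.1 + u - e.2 = (e.1 + t - e.2) + (u - t) := by abel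
    rw [this]; exact norm_add_le _ _
  rcases eq_or_ne p ∞ with rfl | h
  · rw [matchCost_top, matchCost_top]
    have : (M.sup fun e => ‖e.1 + u - e.2‖₊ : ℝ≥0) ≤
        (M.sup fun e => ‖e.1 + t - e.2‖₊ : ℝ≥0) + ‖u - t‖₊ := by
      refine Finset.sup_le fun e he => ?_
      have h1 : ‖e.1 + u - e.2‖₊ ≤ ‖e.1 + t - e.2‖₊ + ‖u - t‖₊ := tri e
      exact h1.trans (add_le_add_left
        (Finset.le_sup (f := fun e : Plane × Plane => ‖e.1 + t - e.2‖₊) he) _)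
    exact_mod_cast this
  · have hq := one_le_toReal hp h
    rw [matchCost_of_ne_top h, matchCost_of_ne_top h]
    set q := p.toReal
    have q0 : 0 < q := by linarith
    rcases M.eq_empty_or_nonempty with rfl | hM
    · simp [Real.zero_rpow (inv_pos.2 q0).ne']
    have hk : (0 : ℝ) < M.card := by exact_mod_cast hM.card_pos
    have mono : ∑ e ∈ M, ‖e.1 + u - e.2‖ ^ q ≤
        ∑ e ∈ M, (‖e.1 + t - e.2‖ + ‖u - t‖) ^ q :=
      Finset.sum_le_sum fun e _ => Real.rpow_le_rpow (norm_nonneg _) (tri e) q0.le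
    have mink := Real.Lp_add_le_of_nonneg M (f := fun e => ‖e.1 + t - e.2‖)
      (g := fun _ => ‖u - t‖) hq (fun _ _ => norm_nonneg _) (fun _ _ => norm_nonneg _)
    have hc : (0 : ℝ) ≤ 1 / (M.card : ℝ) := by positivity
    rw [Real.mul_rpow hc (by positivity), Real.mul_rpow hc (by positivity)]
    have hconst : (1 / (M.card : ℝ)) ^ (1 / q) * (∑ _e ∈ M, ‖u - t‖ ^ q) ^ (1 / q) = ‖u - t‖ := by
      rw [← Real.mul_rpow hc (by positivity), Finset.sum_const, nsmul_eq_mul, ← mul_assoc,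
        one_div_mul_cancel hk.ne', one_mul, one_div, Real.rpow_rpow_inv (norm_nonneg _) q0.ne']
    refine (mul_le_mul_of_nonneg_left ((Real.rpow_le_rpow ?_ mono (one_div_nonneg.2 q0.le)).trans
      mink) (Real.rpow_nonneg hc _)).trans_eq ?_
    · exact Finset.sum_nonneg fun e _ => Real.rpow_nonneg (norm_nonneg _) _
    · rw [mul_add, hconst]

section Existence

variable {p : ℝ≥0∞} {A B : Finset Plane} {k : ℕ}

theorem finite_kMatchings (A B : Finset Plane) (k : ℕ) :
    Finite {M : Finset (Plane × Plane) // IsKMatching A B k M} :=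
  Finite.of_injective
    (fun M => (⟨M.1, Finset.mem_powerset.2 M.2.1⟩ : {M // M ∈ (A ×ˢ B).powerset}))
    fun M N h => Subtype.ext (by simpa using h)

theorem nonempty_kMatchings (hA : k ≤ A.card) (hB : k ≤ B.card) :
    Nonempty {M : Finset (Plane × Plane) // IsKMatching A B k M} := by
  classical
  obtain ⟨A', hA', cA⟩ := Finset.exists_subset_card_eq hA
  obtain ⟨B', hB', cB⟩ := Finset.exists_subset_card_eq hB
  let f := A'.equivFinOfCardEq cA
  let g := B'.equivFinOfCardEq cB
  have hf : Function.Injective fun l => ((f.symm l : Plane)) :=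
    Subtype.val_injective.comp f.symm.injective
  have hg : Function.Injective fun l => ((g.symm l : Plane)) :=
    Subtype.val_injective.comp g.symm.injective
  refine ⟨Finset.univ.image fun l => ((f.symm l : Plane), (g.symm l : Plane)), ?_, ?_, ?_, ?_⟩
  · intro e he
    obtain ⟨l, -, rfl⟩ := Finset.mem_image.1 he
    exact Finset.mem_product.2 ⟨hA' (f.symm l).2, hB' (g.symm l).2⟩
  · rw [Finset.card_image_of_injective _ fun l l' h => hf (congrArg Prod.fst h)]
    simp
  · intro e he e' he' h
    obtain ⟨l, -, rfl⟩ := Finset.mem_image.1 (Finset.mem_coe.1 he)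
    obtain ⟨l', -, rfl⟩ := Finset.mem_image.1 (Finset.mem_coe.1 he')
    rw [hf h]
  · intro e he e' he' h
    obtain ⟨l, -, rfl⟩ := Finset.mem_image.1 (Finset.mem_coe.1 he)
    obtain ⟨l', -, rfl⟩ := Finset.mem_image.1 (Finset.mem_coe.1 he')
    rw [hg h]

theorem optCost_le {M : Finset (Plane × Plane)} (hM : IsKMatching A B k M) (t : Plane) :
    optCost p A B k t ≤ matchCost p M t :=
  have := finite_kMatchings A B k
  ciInf_le (f := fun M : {M : Finset (Plane × Plane) // IsKMatching A B k M} => matchCost p M.1 t)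
    (Set.finite_range _).bddBelow ⟨M, hM⟩

theorem exists_matchCost_eq_optCost (p : ℝ≥0∞) (hA : k ≤ A.card) (hB : k ≤ B.card) (t : Plane) :
    ∃ M, IsKMatching A B k M ∧ matchCost p M t = optCost p A B k t := by
  have := finite_kMatchings A B k
  have := nonempty_kMatchings hA hB
  obtain ⟨M, hM⟩ := exists_eq_ciInf_of_finite
    (f := fun M : {M : Finset (Plane × Plane) // IsKMatching A B k M} => matchCost p M.1 t)
  exact ⟨M.1, M.2, hM⟩

theorem optCost_nonneg (p : ℝ≥0∞) (A B : Finset Plane) (k : ℕ) (t : Plane) :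
    0 ≤ optCost p A B k t :=
  Real.iInf_nonneg fun M => matchCost_nonneg p M.1 t

theorem optCost_le_add (hp : 1 ≤ p) (hA : k ≤ A.card) (hB : k ≤ B.card) (t u : Plane) :
    optCost p A B k u ≤ optCost p A B k t + ‖u - t‖ := by
  obtain ⟨M, hM, h⟩ := exists_matchCost_eq_optCost p hA hB t
  rw [← h]
  exact (optCost_le hM u).trans (matchCost_le_add hp M t u)

theorem continuous_matchCost (hp : 1 ≤ p) (M : Finset (Plane × Plane)) :
    Continuous (matchCost p M) := by
  refine (LipschitzWith.of_le_add fun u t => ?_).continuous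
  rw [dist_eq_norm]
  exact matchCost_le_add hp M t u

/-- Every edge of a matching contributes at least its length, up to a constant factor. -/
theorem norm_le_mul_matchCost (hp : 1 ≤ p) {M : Finset (Plane × Plane)} {e : Plane × Plane}
    (he : e ∈ M) (t : Plane) : ‖e.1 + t - e.2‖ ≤ M.card * matchCost p M t := by
  have hk : (1 : ℝ) ≤ M.card := by exact_mod_cast (Finset.card_pos.2 ⟨e, he⟩)
  rcases eq_or_ne p ∞ with rfl | h
  · have h1 : ‖e.1 + t - e.2‖ ≤ matchCost ∞ M t := by
      rw [matchCost_top]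
      have := Finset.le_sup (f := fun e : Plane × Plane => ‖e.1 + t - e.2‖₊) he
      exact_mod_cast this
    exact h1.trans (le_mul_of_one_le_left (matchCost_nonneg _ _ _) hk)
  · have hq := one_le_toReal hp h
    rw [matchCost_of_ne_top h]
    set q := p.toReal
    have q0 : 0 < q := by linarith
    have h1 : ‖e.1 + t - e.2‖ ^ q ≤ ∑ e ∈ M, ‖e.1 + t - e.2‖ ^ q :=
      Finset.single_le_sum (f := fun e : Plane × Plane => ‖e.1 + t - e.2‖ ^ q)
        (fun _ _ => by positivity) he
    have h2 : ‖e.1 + t - e.2‖ ≤ (∑ e ∈ M, ‖e.1 + t - e.2‖ ^ q) ^ (1 / q) := by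
      calc ‖e.1 + t - e.2‖ = (‖e.1 + t - e.2‖ ^ q) ^ (1 / q) := by
            rw [one_div, Real.rpow_rpow_inv (norm_nonneg _) q0.ne']
        _ ≤ _ := by gcongr
    rw [Real.mul_rpow (by positivity) (by positivity), ← mul_assoc]
    refine h2.trans (le_mul_of_one_le_left (by positivity) ?_)
    rw [one_div, Real.inv_rpow (by positivity), ← div_eq_mul_inv, one_le_div (by positivity)]
    calc (M.card : ℝ) ^ (1 / q) ≤ (M.card : ℝ) ^ (1 : ℝ) :=
          Real.rpow_le_rpow_of_exponent_le hk (by rw [div_le_one q0]; exact hq)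
      _ = _ := Real.rpow_one _

theorem exists_forall_matchCost_le (hp : 1 ≤ p) (M : Finset (Plane × Plane)) (hM : M.Nonempty) :
    ∃ t, ∀ u, matchCost p M t ≤ matchCost p M u := by
  obtain ⟨e, he⟩ := hM
  have hk : (0 : ℝ) < M.card := by exact_mod_cast (Finset.card_pos.2 ⟨e, he⟩)
  refine (continuous_matchCost hp M).exists_forall_le ?_
  refine Filter.tendsto_atTop_mono (f := fun t : Plane => (‖t‖ + -‖e.1 - e.2‖) / M.card)
    (fun t => ?_) ?_
  · rw [div_le_iff₀ hk, mul_comm]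
    refine le_trans ?_ (norm_le_mul_matchCost hp he t)
    have h := norm_sub_le (e.1 + t - e.2) (e.1 - e.2)
    rw [show (e.1 + t - e.2) - (e.1 - e.2) = t by abel] at h
    linarith
  · exact (Filter.tendsto_atTop_add_const_right _ _ (tendsto_norm_cocompact_atTop)).atTop_div_const
      hk

theorem exists_forall_optCost_le (hp : 1 ≤ p) (hk : 1 ≤ k) (hA : k ≤ A.card) (hB : k ≤ B.card) :
    ∃ t, ∀ u, optCost p A B k t ≤ optCost p A B k u := by
  have := finite_kMatchings A B k
  have := nonempty_kMatchings hA hB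
  choose τ hτ using fun M : {M : Finset (Plane × Plane) // IsKMatching A B k M} =>
    exists_forall_matchCost_le hp M.1 (Finset.card_pos.1 (by rw [M.2.2.1]; omega))
  obtain ⟨M, hM⟩ := Finite.exists_min fun M => matchCost p M.1 (τ M)
  refine ⟨τ M, fun u => ?_⟩
  obtain ⟨M', hM', h⟩ := exists_matchCost_eq_optCost p hA hB u
  rw [← h]
  exact (optCost_le M.2 _).trans ((hM ⟨M', hM'⟩).trans (hτ ⟨M', hM'⟩ u))

end Existence

open scoped Classical in
/-- Markov's inequality: at least half of the edges of a matching have length at most twice the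
cost. -/
theorem card_le_two_mul_card_short {p : ℝ≥0∞} (hp : 1 ≤ p) (M : Finset (Plane × Plane))
    (t : Plane) :
    M.card ≤ 2 * (M.filter fun e => ‖e.1 + t - e.2‖ ≤ 2 * matchCost p M t).card := by
  rcases eq_or_ne p ∞ with rfl | h
  · rw [Finset.filter_true_of_mem]
    · omega
    · intro e he
      have h0 := matchCost_nonneg ∞ M t
      have h1 : ‖e.1 + t - e.2‖ ≤ matchCost ∞ M t := by
        rw [matchCost_top]
        have := Finset.le_sup (f := fun e : Plane × Plane => ‖e.1 + t - e.2‖₊) he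
        exact_mod_cast this
      linarith
  · have hq := one_le_toReal hp h
    set r := matchCost p M t with hr
    have hr0 : 0 ≤ r := matchCost_nonneg p M t
    rw [matchCost_of_ne_top h] at hr
    set q := p.toReal
    have q0 : 0 < q := by linarith
    have hsplit := Finset.card_filter_add_card_filter_not (s := M)
      (fun e => ‖e.1 + t - e.2‖ ≤ 2 * r)
    set bad := M.filter fun e => ¬ ‖e.1 + t - e.2‖ ≤ 2 * r with hbad
    suffices 2 * bad.card ≤ M.card by omega
    rcases M.eq_empty_or_nonempty with hM | hM
    · simp [hbad, hM]
    have hk : (0 : ℝ) < M.card := by exact_mod_cast hM.card_pos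
    have hsum : ∑ e ∈ M, ‖e.1 + t - e.2‖ ^ q = M.card * r ^ q := by
      rw [hr, one_div q, Real.rpow_inv_rpow (by positivity) q0.ne', ← mul_assoc,
        mul_one_div_cancel hk.ne', one_mul]
    rcases hr0.eq_or_lt with hr0 | hr0
    · suffices bad = ∅ by simp [this]
      rw [hbad, Finset.filter_eq_empty_iff]
      intro e he
      have h0 : ∑ e ∈ M, ‖e.1 + t - e.2‖ ^ q = 0 := by
        rw [hsum, ← hr0, Real.zero_rpow q0.ne', mul_zero]
      have := (Finset.sum_eq_zero_iff_of_nonneg (fun _ _ => by positivity)).1 h0 e he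
      rw [Real.rpow_eq_zero (norm_nonneg _) q0.ne'] at this
      rw [this, ← hr0, mul_zero]
      exact not_not.2 le_rfl
    · have h1 : (bad.card : ℝ) * (2 * r) ^ q ≤ M.card * r ^ q := by
        rw [← hsum, ← nsmul_eq_mul]
        calc bad.card • (2 * r) ^ q ≤ ∑ e ∈ bad, ‖e.1 + t - e.2‖ ^ q := by
              refine Finset.card_nsmul_le_sum _ _ _ fun e he => ?_
              have := (Finset.mem_filter.1 he).2
              exact Real.rpow_le_rpow (by positivity) (not_le.1 this).le q0.le
          _ ≤ _ := Finset.sum_le_sum_of_subset_of_nonneg (Finset.filter_subset _ _)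
              fun _ _ _ => by positivity
      rw [Real.mul_rpow (by norm_num) hr0.le, ← mul_assoc] at h1
      have h2 : (bad.card : ℝ) * 2 ^ q ≤ M.card := le_of_mul_le_mul_right h1 (by positivity)
      have h3 : (2 : ℝ) ≤ 2 ^ q := by
        calc (2 : ℝ) = 2 ^ (1 : ℝ) := (Real.rpow_one 2).symm
          _ ≤ _ := Real.rpow_le_rpow_of_exponent_le (by norm_num) hq
      have h4 : (bad.card : ℝ) * 2 ≤ M.card :=
        (mul_le_mul_of_nonneg_left h3 (Nat.cast_nonneg _)).trans h2
      have h5 : bad.card * 2 ≤ M.card := by exact_mod_cast h4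
      omega

section Translate

variable {p : ℝ≥0∞}

/-- Translating the first endpoints of a matching. -/
def shiftEdge (t : Plane) : Plane × Plane ↪ Plane × Plane where
  toFun e := (e.1 + t, e.2)
  inj' _ _ h := Prod.ext (add_right_cancel (congrArg Prod.fst h)) (congrArg Prod.snd h :)

@[simp] theorem shiftEdge_apply (t : Plane) (e : Plane × Plane) :
    shiftEdge t e = (e.1 + t, e.2) := rfl

theorem matchCost_map_shiftEdge (M : Finset (Plane × Plane)) (t : Plane) :
    matchCost p (M.map (shiftEdge t)) 0 = matchCost p M t := by
  rcases eq_or_ne p ∞ with rfl | h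
  · rw [matchCost_top, matchCost_top, Finset.sup_map]
    simp [Function.comp_def]
  · rw [matchCost_of_ne_top h, matchCost_of_ne_top h]
    simp

theorem mem_pointSet {m : ℕ} {a : Fin m → Plane} {x : Plane} :
    x ∈ pointSet a ↔ ∃ i, a i = x := by
  simp [pointSet]

theorem card_pointSet {m : ℕ} {a : Fin m → Plane} (ha : Function.Injective a) :
    (pointSet a).card = m := by
  rw [pointSet, Finset.card_image_of_injective _ ha]; simp

theorem isKMatching_map_shiftEdge {m k : ℕ} {a : Fin m → Plane} {B : Finset Plane} {t : Plane}
    {M : Finset (Plane × Plane)} :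
    IsKMatching (pointSet fun i => a i + t) B k (M.map (shiftEdge t)) ↔
      IsKMatching (pointSet a) B k M := by
  have hmem : ∀ e, e ∈ M.map (shiftEdge t) ↔ ∃ e' ∈ M, (e'.1 + t, e'.2) = e := fun e => by
    simp
  refine and_congr ?_ (and_congr (by simp) (and_congr ?_ ?_))
  · simp only [Finset.subset_iff, hmem, Finset.mem_product, mem_pointSet]
    constructor
    · intro h e he
      obtain ⟨⟨i, hi⟩, h2⟩ := h ⟨e, he, rfl⟩
      exact ⟨⟨i, by simpa using hi⟩, h2⟩
    · rintro h _ ⟨e, he, rfl⟩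
      obtain ⟨⟨i, hi⟩, h2⟩ := h he
      exact ⟨⟨i, by simp [hi]⟩, h2⟩
  all_goals
    simp only [Set.InjOn, Finset.mem_coe, hmem]
    constructor
    · intro h e he e' he' hee
      exact (shiftEdge t).injective (h ⟨e, he, rfl⟩ ⟨e', he', rfl⟩ (by simp [hee]))
    · rintro h _ ⟨e, he, rfl⟩ _ ⟨e', he', rfl⟩ hee
      rw [h he he' (by simpa using hee)]

theorem optCost_translate_le {m n k : ℕ} {a : Fin m → Plane} {b : Fin n → Plane}
    (ha : Function.Injective a) (hb : Function.Injective b) (hm : k ≤ m) (hn : k ≤ n)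
    (t : Plane) :
    optCost p (pointSet fun i => a i + t) (pointSet b) k 0 ≤
      optCost p (pointSet a) (pointSet b) k t := by
  obtain ⟨M, hM, h⟩ := exists_matchCost_eq_optCost (A := pointSet a) (B := pointSet b) (k := k) p
    (by rwa [card_pointSet ha]) (by rwa [card_pointSet hb]) t
  rw [← h, ← matchCost_map_shiftEdge]
  exact optCost_le (isKMatching_map_shiftEdge.2 hM) 0

/-- Applied to a translated copy of the first point set, the black box yields a nearly optimal
matching for this translation. -/
theorem StationarySolver.exists_isKMatching_translate (O : StationarySolver p) {m n k : ℕ} {δ : ℝ}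
    {a : Fin m → Plane} {b : Fin n → Plane} (ha : Function.Injective a)
    (hb : Function.Injective b) (hk : 1 ≤ k) (hmn : k ≤ min m n) (hδ : 0 < δ) (hδ1 : δ ≤ 1)
    (t : Plane) :
    ∃ M, Encodes a b k (O.solve (fun i => a i + t) b k δ) M ∧
      IsKMatching (pointSet a) (pointSet b) k M ∧
      matchCost p M t ≤ (1 + δ) * optCost p (pointSet a) (pointSet b) k t := by
  classical
  obtain ⟨hm, hn⟩ := le_min_iff.1 hmn
  obtain ⟨M, ⟨i, j, hij, rfl⟩, hM, hcost⟩ := O.correct (fun i => a i + t) b k δ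
    (fun x y h => ha (add_right_cancel h)) hb hk hmn hδ hδ1
  have himg : (Finset.univ.image fun l => ((a (i l) + t, b (j l)) : Plane × Plane)) =
      (Finset.univ.image fun l => (a (i l), b (j l))).map (shiftEdge t) := by
    ext e; simp
  have hM' : IsKMatching (pointSet fun i => a i + t) (pointSet b) k
      ((Finset.univ.image fun l => (a (i l), b (j l))).map (shiftEdge t)) := by
    rw [← himg]; convert hM
  have hcost' : matchCost p
      ((Finset.univ.image fun l => (a (i l), b (j l))).map (shiftEdge t)) 0 ≤
        (1 + δ) * optCost p (pointSet fun i => a i + t) (pointSet b) k 0 := by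
    rw [← himg]; convert hcost
  refine ⟨_, ⟨i, j, hij, rfl⟩, ?_, ?_⟩
  · convert isKMatching_map_shiftEdge.1 hM'
  · rw [matchCost_map_shiftEdge] at hcost'
    refine le_trans ?_ (hcost'.trans (mul_le_mul_of_nonneg_left
      (optCost_translate_le ha hb hm hn t) (by linarith)))
    apply le_of_eq
    congr!

end Translate

open scoped Classical in
/-- The value accumulated by a loop over edges of lengths `len 0, len 1, …`: the maximum of the
lengths if `p = ∞`, and the sum of their `p`-th powers otherwise. -/
noncomputable def costAcc (p : ℝ≥0∞) (len : ℕ → ℝ) : ℕ → ℝ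
  | 0 => 0
  | u + 1 => if p = ∞ then max (costAcc p len u) (len u) else costAcc p len u + len u ^ p.toReal

open scoped Classical in
/-- The cost of a matching that is given as a list of index pairs, computed along that list. -/
theorem matchCost_eq_costAcc {p : ℝ≥0∞} {m n k : ℕ} {a : Fin m → Plane} {b : Fin n → Plane}
    {i : Fin k → Fin m} {j : Fin k → Fin n} {M : Finset (Plane × Plane)}
    (hM : M = Finset.univ.image fun l => (a (i l), b (j l))) (hcard : M.card = k) (t : Plane)
    (len : ℕ → ℝ) (hlen : ∀ l : Fin k, len l = ‖a (i l) + t - b (j l)‖) :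
    matchCost p M t =
      if p = ∞ then costAcc p len k else (costAcc p len k / k) ^ (1 / p.toReal) := by
  have hinj : Function.Injective fun l : Fin k => (a (i l), b (j l)) := by
    rw [← Set.injOn_univ, ← Finset.coe_univ, ← Finset.card_image_iff, ← hM, hcard]
    simp
  rcases eq_or_ne p ∞ with rfl | h
  · have key : ∀ u (hu : u ≤ k), costAcc ∞ len u =
        ((Finset.univ.sup fun l : Fin u => ‖a (i (l.castLE hu)) + t - b (j (l.castLE hu))‖₊ : ℝ≥0) :
          ℝ) := by
      intro u
      induction u with
      | zero => intro _; simp [costAcc]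
      | succ u ih =>
        intro hu
        rw [costAcc, if_pos rfl, ih (by omega), Fin.univ_castSuccEmb, Finset.sup_cons,
          Finset.sup_map, NNReal.coe_max, max_comm]
        have := hlen ((Fin.last u).castLE hu)
        simp only [Fin.val_castLE, Fin.val_last] at this
        rw [this]
        rfl
    rw [if_pos rfl, key k le_rfl, matchCost_top, hM, Finset.sup_image]
    rfl
  · have key : ∀ u (hu : u ≤ k), costAcc p len u =
        ∑ l : Fin u, ‖a (i (l.castLE hu)) + t - b (j (l.castLE hu))‖ ^ p.toReal := by
      intro u
      induction u with
      | zero => intro _; simp [costAcc]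
      | succ u ih =>
        intro hu
        rw [costAcc, if_neg h, ih (by omega), Fin.sum_univ_castSucc]
        have := hlen ((Fin.last u).castLE hu)
        simp only [Fin.val_castLE, Fin.val_last] at this
        rw [this]
        rfl
    rw [if_neg h, key k le_rfl, matchCost_of_ne_top h, hcard]
    rw [hM, Finset.sum_image hinj.injOn, one_div (k : ℝ), inv_mul_eq_div]
    rfl

theorem costAcc_nonneg {p : ℝ≥0∞} {len : ℕ → ℝ} (h : ∀ l, 0 ≤ len l) (u : ℕ) :
    0 ≤ costAcc p len u := by
  induction u with
  | zero => exact le_rfl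
  | succ u ih =>
    rw [costAcc]
    split_ifs
    · exact le_max_of_le_left ih
    · exact add_nonneg ih (Real.rpow_nonneg (h u) _)

/-! ### Nets for boxes from the levels of a merge sort -/

section Net

variable {α : Type*}

/-- The `w` consecutive entries of `Z` from position `i` on. -/
def slice (Z : ℕ → α) (i w : ℕ) : List α :=
  (List.range w).map fun l => Z (i + l)

@[simp] theorem length_slice (Z : ℕ → α) (i w : ℕ) : (slice Z i w).length = w := by
  simp [slice]

@[simp] theorem slice_zero (Z : ℕ → α) (i : ℕ) : slice Z i 0 = [] := rfl

theorem slice_succ (Z : ℕ → α) (i w : ℕ) :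
    slice Z i (w + 1) = slice Z i w ++ [Z (i + w)] := by
  simp [slice, List.range_succ]

theorem slice_add (Z : ℕ → α) (i v w : ℕ) :
    slice Z i (v + w) = slice Z i v ++ slice Z (i + v) w := by
  induction w with
  | zero => simp
  | succ w ih => rw [← add_assoc, slice_succ, ih, slice_succ, List.append_assoc, add_assoc]

theorem slice_succ_left (Z : ℕ → α) (i w : ℕ) :
    slice Z i (w + 1) = Z i :: slice Z (i + 1) w := by
  rw [add_comm, slice_add]; rfl

theorem slice_congr {Z Z' : ℕ → α} {i i' w : ℕ} (h : ∀ l < w, Z (i + l) = Z' (i' + l)) :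
    slice Z i w = slice Z' i' w :=
  List.map_congr_left fun l hl => h l (List.mem_range.1 hl)

theorem mem_slice {Z : ℕ → α} {i w : ℕ} {z : α} :
    z ∈ slice Z i w ↔ ∃ l < w, Z (i + l) = z := by
  simp [slice]

theorem getElem_slice {Z : ℕ → α} {i w l : ℕ} (h : l < (slice Z i w).length) :
    (slice Z i w)[l] = Z (i + l) := by
  simp [slice]

theorem rel_of_pairwise_slice {Z : ℕ → α} {R : α → α → Prop} {i w u v : ℕ}
    (h : (slice Z i w).Pairwise R) (huv : u < v) (hv : v < w) : R (Z (i + u)) (Z (i + v)) := by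
  have := List.pairwise_iff_getElem.1 h u v (by simpa using huv.trans hv) (by simpa using hv) huv
  simpa [getElem_slice] using this

/-- An interval of positions in `[0, 2 ^ L)` is a union of at most `2 L + 1` dyadic intervals, so
one of these contains at least `s` entries with the property `P` if the interval contains more than
`(2 L + 1) (s - 1)` of them. -/
theorem exists_dyadic_of_lt_countP (P : α → Bool) (Z : ℕ → α) (L s u v : ℕ) (huv : u ≤ v)
    (hv : v ≤ 2 ^ L) (h : (2 * L + 1) * (s - 1) < (slice Z u (v - u)).countP P) :
    ∃ j c, j ≤ L ∧ u ≤ c * 2 ^ j ∧ (c + 1) * 2 ^ j ≤ v ∧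
      s ≤ (slice Z (c * 2 ^ j) (2 ^ j)).countP P := by
  by_contra! hno
  -- induction on `L - j`, for intervals whose ends are multiples of `2 ^ j`
  suffices H : ∀ d j, j + d = L → ∀ c e, c ≤ e → u ≤ c * 2 ^ j → e * 2 ^ j ≤ v →
      (slice Z (c * 2 ^ j) (e * 2 ^ j - c * 2 ^ j)).countP P ≤ (2 * d + 1) * (s - 1) by
    have := H L 0 (by simp) u v huv (by simp) (by simp)
    simp only [pow_zero, mul_one] at this
    omega
  intro d
  induction d with
  | zero =>
    intro j hj c e hce hc he
    obtain rfl : j = L := by simpa using hj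
    have he1 : e ≤ 1 := by
      by_contra! h2
      have : 2 * 2 ^ j ≤ e * 2 ^ j := Nat.mul_le_mul_right _ h2
      have : 0 < 2 ^ j := by positivity
      omega
    rcases hce.eq_or_lt with rfl | hlt
    · simp
    · obtain ⟨rfl, rfl⟩ : c = 0 ∧ e = 1 := by omega
      have := hno j 0 le_rfl hc (by simpa using he)
      simp only [zero_mul, one_mul, Nat.sub_zero] at this ⊢
      omega
  | succ d ih =>
    intro j hj c e hce hc he
    have hp : 2 ^ (j + 1) = 2 * 2 ^ j := by rw [pow_succ, mul_comm]
    -- the interval without its first block, respectively its last block, if they stick out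
    have main : ∀ c' e', c ≤ 2 * c' → 2 * c' ≤ c + 1 → e ≤ 2 * e' + 1 → 2 * e' ≤ e → c' ≤ e' →
        (slice Z (c * 2 ^ j) (e * 2 ^ j - c * 2 ^ j)).countP P ≤
          (2 * (d + 1) + 1) * (s - 1) := by
      intro c' e' h1 h2 h3 h4 h5
      have hc' : c' * 2 ^ (j + 1) = (2 * c') * 2 ^ j := by rw [hp]; ring
      have he' : e' * 2 ^ (j + 1) = (2 * e') * 2 ^ j := by rw [hp]; ring
      have mid := ih (j + 1) (by omega) c' e' h5
        (by rw [hc']; exact hc.trans (Nat.mul_le_mul_right _ h1))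
        (by rw [he']; exact (Nat.mul_le_mul_right _ h4).trans he)
      rw [hc', he'] at mid
      have block : ∀ x y, c ≤ x → y ≤ e → x ≤ y → y ≤ x + 1 →
          (slice Z (x * 2 ^ j) (y * 2 ^ j - x * 2 ^ j)).countP P ≤ s - 1 := by
        intro x y hx hy hxy hyx
        rcases hxy.eq_or_lt with rfl | hlt
        · simp
        · obtain rfl : y = x + 1 := by omega
          have := hno j x (by omega) (hc.trans (Nat.mul_le_mul_right _ hx))
            ((Nat.mul_le_mul_right _ hy).trans he)
          rw [show (x + 1) * 2 ^ j - x * 2 ^ j = 2 ^ j by rw [add_mul, one_mul]; omega]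
          omega
      have b1 := block c (2 * c') le_rfl (by omega) h1 h2
      have b2 := block (2 * e') e (by omega) le_rfl h4 h3
      have m1 := Nat.mul_le_mul_right (2 ^ j) h1
      have m2 := Nat.mul_le_mul_right (2 ^ j) (show 2 * c' ≤ 2 * e' by omega)
      have m3 := Nat.mul_le_mul_right (2 ^ j) h4
      rw [show e * 2 ^ j - c * 2 ^ j = (2 * c' * 2 ^ j - c * 2 ^ j) +
        ((2 * e' * 2 ^ j - 2 * c' * 2 ^ j) + (e * 2 ^ j - 2 * e' * 2 ^ j)) by omega,
        slice_add, slice_add,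
        show c * 2 ^ j + (2 * c' * 2 ^ j - c * 2 ^ j) = 2 * c' * 2 ^ j by omega,
        show 2 * c' * 2 ^ j + (2 * e' * 2 ^ j - 2 * c' * 2 ^ j) = 2 * e' * 2 ^ j by omega,
        List.countP_append, List.countP_append]
      have : (2 * (d + 1) + 1) * (s - 1) = (s - 1) + ((2 * d + 1) * (s - 1) + (s - 1)) := by ring
      omega
    by_cases hle : (c + 1) / 2 ≤ e / 2
    · exact main ((c + 1) / 2) (e / 2) (by omega) (by omega) (by omega) (by omega) hle
    · obtain rfl : c = e := by omega
      simp

theorem countP_slice (P : α → Bool) (Z : ℕ → α) (i w : ℕ) :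
    (slice Z i w).countP P = ((Finset.range w).filter fun l => P (Z (i + l))).card := by
  induction w with
  | zero => simp
  | succ w ih =>
    rw [slice_succ, List.countP_append, ih, Finset.range_add_one, Finset.filter_insert]
    by_cases hw : P (Z (i + w)) <;> simp [hw]

/-- If the entries with the property `P` are consecutive in a slice, and there are at least `s` of
them, then one of them is at a position divisible by `s`. -/
theorem exists_dvd_of_le_countP (P : α → Bool) (Z : ℕ → α) (i w s : ℕ) (hs : 1 ≤ s)
    (hconv : ∀ x y z, x ≤ y → y ≤ z → z < w → P (Z (i + x)) → P (Z (i + z)) → P (Z (i + y)))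
    (h : s ≤ (slice Z i w).countP P) : ∃ q, i ≤ q ∧ q < i + w ∧ s ∣ q ∧ P (Z q) := by
  rw [countP_slice] at h
  set F := (Finset.range w).filter fun l => P (Z (i + l)) with hF
  have hne : F.Nonempty := Finset.card_pos.1 (by omega)
  have hmin := F.min'_mem hne
  have hmax := F.max'_mem hne
  set x := F.min' hne
  set z := F.max' hne
  have hsub : F ⊆ Finset.Icc x z := fun l hl =>
    Finset.mem_Icc.2 ⟨F.min'_le l hl, F.le_max' l hl⟩
  have hcard := Finset.card_le_card hsub
  rw [Nat.card_Icc] at hcard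
  simp only [hF, Finset.mem_filter, Finset.mem_range] at hmin hmax
  -- the first multiple of `s` from position `i + x` on
  obtain ⟨q, hq⟩ : ∃ q, q = (i + x + (s - 1)) / s * s := ⟨_, rfl⟩
  have h1 := Nat.div_add_mod (i + x + (s - 1)) s
  have h2 := Nat.mod_lt (i + x + (s - 1)) (by omega : 0 < s)
  rw [mul_comm, ← hq] at h1
  refine ⟨q, by omega, by omega, hq ▸ Nat.dvd_mul_left _ _, ?_⟩
  have := hconv x (q - i) z (by omega) (by omega) hmax.1 hmin.2 hmax.2
  rwa [show i + (q - i) = q by omega] at this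

open scoped Classical in
/-- The entries of a slice that lie in an interval with respect to a key by which the slice is
sorted are consecutive. -/
theorem exists_positions_of_sorted (Z : ℕ → α) (key : α → ℝ) (i w : ℕ) (lo hi : ℝ)
    (hsort : (slice Z i w).Pairwise fun x y => key x ≤ key y) :
    ∃ u v, u ≤ v ∧ v ≤ w ∧ ∀ l < w,
      (u ≤ l ∧ l < v) ↔ (lo ≤ key (Z (i + l)) ∧ key (Z (i + l)) ≤ hi) := by
  have mono : ∀ x y, x ≤ y → y < w → key (Z (i + x)) ≤ key (Z (i + y)) := by
    intro x y hxy hy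
    rcases hxy.eq_or_lt with rfl | hlt
    · exact le_rfl
    · exact rel_of_pairwise_slice hsort hlt hy
  have hu : ∃ u, u = w ∨ (u < w ∧ lo ≤ key (Z (i + u))) := ⟨w, Or.inl rfl⟩
  have hv : ∃ v, v = w ∨ (v < w ∧ hi < key (Z (i + v))) := ⟨w, Or.inl rfl⟩
  have hu1 := Nat.find_spec hu
  have hv1 := Nat.find_spec hv
  have hu2 : ∀ x < Nat.find hu, _ := fun x hx => Nat.find_min hu hx
  have hv2 : ∀ x < Nat.find hv, _ := fun x hx => Nat.find_min hv hx
  set u := Nat.find hu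
  set v := Nat.find hv
  have huw : u ≤ w := by rcases hu1 with h | h <;> omega
  have hvw : v ≤ w := by rcases hv1 with h | h <;> omega
  have iu : ∀ l < w, u ≤ l ↔ lo ≤ key (Z (i + l)) := by
    intro l hl
    constructor
    · intro hul
      rcases hu1 with h | h
      · omega
      · exact h.2.trans (mono u l hul hl)
    · intro hlo
      by_contra! hlt
      exact hu2 l hlt (Or.inr ⟨hl, hlo⟩)
  have iv : ∀ l < w, l < v ↔ key (Z (i + l)) ≤ hi := by
    intro l hl
    constructor
    · intro hlv
      by_contra! hhi
      exact hv2 l hlv (Or.inr ⟨hl, hhi⟩)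
    · intro hhi
      by_contra! hvl
      rcases hv1 with h | h
      · omega
      · exact absurd (h.2.trans_le (mono v l hvl hl)) (not_lt.2 hhi)
  rcases le_or_gt u v with h | h
  · exact ⟨u, v, h, hvw, fun l hl => and_congr (iu l hl) (iv l hl)⟩
  · refine ⟨u, u, le_rfl, huw, fun l hl => ⟨fun hh => absurd hh (by omega), fun hh => ?_⟩⟩
    have := (iu l hl).2 hh.1
    have := (iv l hl).2 hh.2
    omega

open scoped Classical in
/-- A box with many entries of a list `X` contains an entry of every sufficiently fine subsequence of
the levels of a merge sort. Here `Z` holds from position `o` on a copy of `X` that is sorted by the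
first coordinate and then the levels of its merge sort by the second coordinate: level `j` has blocks
of length `2 ^ j`. -/
theorem exists_mem_box (Z : ℕ → ℝ × ℝ) (X : List (ℝ × ℝ)) (L o s : ℕ) (hs : 1 ≤ s)
    (hperm : (slice Z o (2 ^ L)).Perm X)
    (hsort : (slice Z o (2 ^ L)).Pairwise fun x y => x.1 ≤ y.1)
    (hlev : ∀ j ≤ L, ∀ c < 2 ^ (L - j),
      (slice Z (o + j * 2 ^ L + c * 2 ^ j) (2 ^ j)).Perm (slice Z (o + c * 2 ^ j) (2 ^ j)) ∧
      (slice Z (o + j * 2 ^ L + c * 2 ^ j) (2 ^ j)).Pairwise fun x y => x.2 ≤ y.2)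
    (x₁ x₂ y₁ y₂ : ℝ)
    (hcount : (2 * L + 1) * (s - 1) <
      X.countP fun z => (x₁ ≤ z.1 ∧ z.1 ≤ x₂) ∧ (y₁ ≤ z.2 ∧ z.2 ≤ y₂)) :
    ∃ q < o + (L + 1) * 2 ^ L, s ∣ q ∧
      (x₁ ≤ (Z q).1 ∧ (Z q).1 ≤ x₂) ∧ (y₁ ≤ (Z q).2 ∧ (Z q).2 ≤ y₂) := by
  set P : ℝ × ℝ → Bool := fun z => (x₁ ≤ z.1 ∧ z.1 ≤ x₂) ∧ (y₁ ≤ z.2 ∧ z.2 ≤ y₂) with hP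
  rw [← hperm.countP_eq] at hcount
  obtain ⟨u, v, huv, hvw, hiff⟩ := exists_positions_of_sorted Z Prod.fst o (2 ^ L) x₁ x₂ hsort
  set Y : ℕ → ℝ × ℝ := fun l => Z (o + l) with hY
  have hseg : ∀ i w, slice Y i w = slice Z (o + i) w := fun i w =>
    slice_congr fun l _ => by rw [hY, add_assoc]
  have hzero : ∀ i w, (∀ l < w, i + l < 2 ^ L ∧ ¬ (u ≤ i + l ∧ i + l < v)) →
      (slice Y i w).countP P = 0 := by
    intro i w h
    rw [List.countP_eq_zero]
    intro z hz
    obtain ⟨l, hl, rfl⟩ := mem_slice.1 hz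
    obtain ⟨h1, h2⟩ := h l hl
    rw [hiff _ h1] at h2
    simp only [hP, hY, decide_eq_true_eq]
    exact fun h3 => h2 h3.1
  have hcount' : (2 * L + 1) * (s - 1) < (slice Y u (v - u)).countP P := by
    rw [show 2 ^ L = u + ((v - u) + (2 ^ L - v)) by omega, ← add_zero o, ← hseg, slice_add,
      slice_add, List.countP_append, List.countP_append, hzero 0 u fun l hl => by omega,
      hzero (0 + u + (v - u)) (2 ^ L - v) fun l hl => by omega, zero_add, zero_add] at hcount
    exact hcount
  obtain ⟨j, c, hj, huc, hcv, hcnt⟩ := exists_dyadic_of_lt_countP P Y L s u v huv hvw hcount'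
  have hc : c < 2 ^ (L - j) := by
    by_contra! h
    have h1 := Nat.mul_le_mul_right (2 ^ j) (Nat.succ_le_succ h)
    rw [Nat.succ_mul, ← pow_add, Nat.sub_add_cancel hj] at h1
    have : 0 < 2 ^ j := by positivity
    have : c.succ * 2 ^ j = (c + 1) * 2 ^ j := rfl
    omega
  obtain ⟨hpm, hst⟩ := hlev j hj c hc
  rw [hseg, ← hpm.countP_eq] at hcnt
  have hx : ∀ l < 2 ^ j, x₁ ≤ (Z (o + j * 2 ^ L + c * 2 ^ j + l)).1 ∧
      (Z (o + j * 2 ^ L + c * 2 ^ j + l)).1 ≤ x₂ := by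
    intro l hl
    have hmem := hpm.mem_iff.1 (mem_slice.2 ⟨l, hl, rfl⟩)
    obtain ⟨l', hl', he⟩ := mem_slice.1 hmem
    rw [← he, add_assoc]
    have : (c + 1) * 2 ^ j = c * 2 ^ j + 2 ^ j := by ring
    exact (hiff _ (by omega)).1 ⟨by omega, by omega⟩
  obtain ⟨q, hq1, hq2, hq3, hq4⟩ := exists_dvd_of_le_countP P Z _ _ s hs (by
    intro x y z hxy hyz hz h1 h2
    simp only [hP, decide_eq_true_eq] at h1 h2 ⊢
    have mono : ∀ x y, x ≤ y → y < 2 ^ j → (Z (o + j * 2 ^ L + c * 2 ^ j + x)).2 ≤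
        (Z (o + j * 2 ^ L + c * 2 ^ j + y)).2 := by
      intro x y hxy hy
      rcases hxy.eq_or_lt with rfl | hlt
      · exact le_rfl
      · exact rel_of_pairwise_slice hst hlt hy
    exact ⟨hx y (by omega), h1.2.1.trans (mono x y hxy (by omega)),
      (mono y z hyz hz).trans h2.2.2⟩) hcnt
  refine ⟨q, ?_, hq3, by simpa [hP] using hq4⟩
  have h1 : (c + 1) * 2 ^ j ≤ 2 ^ L := hcv.trans hvw
  have h2 : j * 2 ^ L ≤ L * 2 ^ L := Nat.mul_le_mul_right _ hj
  have h3 : (c + 1) * 2 ^ j = c * 2 ^ j + 2 ^ j := by ring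
  have h4 : (L + 1) * 2 ^ L = L * 2 ^ L + 2 ^ L := by ring
  omega

end Net

namespace RealRAM

/-! ### Frames and basic commands -/

attribute [simp] IExp.eval RExp.eval Test.Holds IExp.size RExp.size Test.size
attribute [simp] writeInt_int_self writeInt_int_of_ne writeReal_real_self writeReal_real_of_ne

/-- The states `s` and `s'` agree outside the integer arrays in `I` and the real arrays in `R`. -/
def Frame (I R : List ℕ) (s s' : State) : Prop :=
  (∀ r, r ∉ I → s'.int r = s.int r) ∧ ∀ r, r ∉ R → s'.real r = s.real r

theorem Frame.refl {I R : List ℕ} (s : State) : Frame I R s s :=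
  ⟨fun _ _ => rfl, fun _ _ => rfl⟩

theorem Frame.trans {I R : List ℕ} {s s' s'' : State} (h : Frame I R s s')
    (h' : Frame I R s' s'') : Frame I R s s'' :=
  ⟨fun r hr => (h'.1 r hr).trans (h.1 r hr), fun r hr => (h'.2 r hr).trans (h.2 r hr)⟩

theorem Frame.mono {I R I' R' : List ℕ} {s s' : State} (h : Frame I R s s') (hI : I ⊆ I')
    (hR : R ⊆ R') : Frame I' R' s s' :=
  ⟨fun r hr => h.1 r fun h' => hr (hI h'), fun r hr => h.2 r fun h' => hr (hR h')⟩

theorem Frame.writeInt {I R : List ℕ} {s s' : State} (h : Frame I R s s') {arr : ℕ} (idx v : ℕ)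
    (harr : arr ∈ I) : Frame I R s (s'.writeInt arr idx v) :=
  ⟨fun r hr => (writeInt_int_of_ne _ _ _ fun e => hr (by rw [e]; exact harr)).trans (h.1 r hr), h.2⟩

theorem Frame.writeReal {I R : List ℕ} {s s' : State} (h : Frame I R s s') {arr : ℕ} (idx : ℕ)
    (v : ℝ) (harr : arr ∈ R) : Frame I R s (s'.writeReal arr idx v) :=
  ⟨h.1, fun r hr => (writeReal_real_of_ne _ _ _ fun e => hr (by rw [e]; exact harr)).trans (h.2 r hr)⟩

theorem Frame.int {I R : List ℕ} {s s' : State} (h : Frame I R s s') (r : ℕ)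
    (hr : r ∉ I := by decide) : s'.int r = s.int r := h.1 r hr

theorem Frame.real {I R : List ℕ} {s s' : State} (h : Frame I R s s') (r : ℕ)
    (hr : r ∉ R := by decide) : s'.real r = s.real r := h.2 r hr

/-- The integer variable in cell `c` of the integer array `r`. -/
abbrev iv (r c : ℕ) : IExp := .read r (.const c)

/-- The real variable in cell `c` of the real array `r`. -/
abbrev rv (r c : ℕ) : RExp := .read r (.const c)

/-- Assignment to an integer variable. -/
abbrev setI (r c : ℕ) (e : IExp) : Program := .setInt r (.const c) e

/-- Assignment to a real variable. -/
abbrev setR (r c : ℕ) (e : RExp) : Program := .setReal r (.const c) e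

/-- Increment of an integer variable. -/
abbrev incr (r c : ℕ) : Program := setI r c (.add (iv r c) (.const 1))

/-- The `l`-th point stored in the real arrays `10` and `11`. -/
def pts (s : State) (l : ℕ) : ℝ × ℝ := (s.real 10 l, s.real 11 l)

/-! ### Merge sort that keeps all its levels -/

/-- The coordinate by which the points are sorted: the first one for the array `10`, the second one
for the array `11`. -/
def key (κ : ℕ) (z : ℝ × ℝ) : ℝ := if κ = 10 then z.1 else z.2

open scoped Classical in
/-- The comparison of points by a coordinate. -/
noncomputable def leKey (κ : ℕ) (x y : ℝ × ℝ) : Bool := decide (key κ x ≤ key κ y)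

theorem real_eq_key {κ : ℕ} (hκ : κ = 10 ∨ κ = 11) (s : State) (l : ℕ) :
    s.real κ l = key κ (pts s l) := by
  rcases hκ with rfl | rfl <;> simp [key, pts]

/-- Copy the point with index `i` or `j`, whichever has the smaller key, to position `o`. The cells
`0, …, 4` of the integer array `11` hold `i`, `j`, the ends of the two runs, and `o`. -/
def mergeStep (κ : ℕ) : Program :=
  .seq
    (.ite (.conj (.ltInt (iv 11 0) (iv 11 2)) (.neg (.conj (.ltInt (iv 11 1) (iv 11 3))
        (.ltReal (.read κ (iv 11 1)) (.read κ (iv 11 0))))))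
      (.seq (.setReal 10 (iv 11 4) (.read 10 (iv 11 0)))
        (.seq (.setReal 11 (iv 11 4) (.read 11 (iv 11 0))) (incr 11 0)))
      (.seq (.setReal 10 (iv 11 4) (.read 10 (iv 11 1)))
        (.seq (.setReal 11 (iv 11 4) (.read 11 (iv 11 1))) (incr 11 1))))
    (incr 11 4)

/-- Merge the sorted runs of length `w` at positions `c` and `c + w` to position `c + N'`. Here
`w`, `c` are the cells `0`, `1` of the integer array `10`, and `N'` is stored in array `4`. -/
def mergeRuns (κ : ℕ) : Program :=
  .seq (setI 11 0 (iv 10 1))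
    (.seq (setI 11 1 (.add (iv 10 1) (iv 10 0)))
      (.seq (setI 11 2 (.add (iv 10 1) (iv 10 0)))
        (.seq (setI 11 3 (.add (.add (iv 10 1) (iv 10 0)) (iv 10 0)))
          (.seq (setI 11 4 (.add (iv 10 1) (iv 4 0)))
            (.while (.ltInt (iv 11 4) (.add (iv 11 3) (iv 4 0))) (mergeStep κ))))))

/-- One level of merge sort: the sorted runs of length `w` in the `N'` positions from `base` on are
merged into the next `N'` positions. The number `base` is stored in the integer array `7`. -/
def sortLevel (κ : ℕ) : Program :=
  .seq (setI 10 1 (iv 7 0))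
    (.seq (setI 10 2 (.add (iv 7 0) (iv 4 0)))
      (.while (.ltInt (iv 10 1) (iv 10 2))
        (.seq (mergeRuns κ) (setI 10 1 (iv 11 3)))))

/-- Merge sort of the `N'` points from position `base` on; every level is kept in memory. -/
def sortPhase (κ : ℕ) : Program :=
  .seq (setI 10 0 (.const 1))
    (.while (.ltInt (iv 10 0) (iv 4 0))
      (.seq (sortLevel κ)
        (.seq (setI 7 0 (.add (iv 7 0) (iv 4 0))) (setI 10 0 (.add (iv 10 0) (iv 10 0))))))

section MergeSort

variable {p : ℝ≥0∞} {O : StationarySolver p}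

theorem pts_writeInt (s : State) (arr idx v : ℕ) : pts (s.writeInt arr idx v) = pts s := rfl

theorem pts_eq_of_real {s s' : State} {l l' : ℕ} (h : s'.real 10 l' = s.real 10 l)
    (h' : s'.real 11 l' = s.real 11 l) : pts s' l' = pts s l := by
  simp [pts, h, h']

theorem runs_mergeStep {κ : ℕ} (hκ : κ = 10 ∨ κ = 11) {s : State} {i j mid e o : ℕ}
    (hi : s.int 11 0 = i) (hj : s.int 11 1 = j) (hmid : s.int 11 2 = mid) (he : s.int 11 3 = e)
    (ho : s.int 11 4 = o) :
    Runs O (mergeStep κ) s fun s' T => T ≤ 60 ∧ Frame [11] [10, 11] s s' ∧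
      s'.int 11 2 = mid ∧ s'.int 11 3 = e ∧ s'.int 11 4 = o + 1 ∧
      (∀ l, l ≠ o → pts s' l = pts s l) ∧
      ((i < mid ∧ ¬ (j < e ∧ key κ (pts s j) < key κ (pts s i)) ∧ s'.int 11 0 = i + 1 ∧
          s'.int 11 1 = j ∧ pts s' o = pts s i) ∨
        (¬ (i < mid ∧ ¬ (j < e ∧ key κ (pts s j) < key κ (pts s i))) ∧ s'.int 11 0 = i ∧
          s'.int 11 1 = j + 1 ∧ pts s' o = pts s j)) := by
  have fr : ∀ (x y : ℝ) (v : ℕ) (c : ℕ) (w : ℕ), Frame [11] [10, 11] s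
      ((((s.writeReal 10 o x).writeReal 11 o y).writeInt 11 c v).writeInt 11 4 w) :=
    fun x y v c w => ((((Frame.refl s).writeReal _ _ (by simp)).writeReal _ _ (by simp)).writeInt
      _ _ (by simp)).writeInt _ _ (by simp)
  simp only [mergeStep, runs_seq, runs_ite, runs_setReal, runs_setInt, Test.Holds, IExp.eval,
    RExp.eval, real_eq_key hκ, hi, hj, hmid, he, ho]
  constructor
  · intro h
    refine ⟨by simp, ?_⟩
    simp only [writeReal_int, hi, ho, writeInt_int_self]
    refine ⟨?_, by simp [hmid], by simp [he], by simp, ?_, Or.inl ⟨h.1, h.2, ?_, ?_, ?_⟩⟩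
    · exact fr _ _ _ _ _
    · intro l hl
      simp [pts, hl]
    · simp
    · simp [hj]
    · simp [pts]
  · intro h
    refine ⟨by simp, ?_⟩
    simp only [writeReal_int, hj, ho, writeInt_int_self]
    refine ⟨?_, by simp [hmid], by simp [he], by simp, ?_, Or.inr ⟨h, ?_, ?_, ?_⟩⟩
    · exact fr _ _ _ _ _
    · intro l hl
      simp [pts, hl]
    · simp [hi]
    · simp
    · simp [pts]

/-- The invariant of the loop: the output so far, followed by the merge of the remaining parts of
both runs, is the merge of the runs. -/
theorem runs_mergeRuns {κ : ℕ} (hκ : κ = 10 ∨ κ = 11) {s : State} {c w N : ℕ}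
    (hw : s.int 10 0 = w) (hc : s.int 10 1 = c) (hN : s.int 4 0 = N) (hwN : 2 * w ≤ N) :
    Runs O (mergeRuns κ) s fun s' T => T ≤ 70 * (2 * w) + 80 ∧
      (Frame [11] [10, 11] s s' ∧ s'.int 11 3 = c + 2 * w ∧
      (∀ l, ¬ (c + N ≤ l ∧ l < c + N + 2 * w) → pts s' l = pts s l) ∧
      slice (pts s') (c + N) (2 * w) =
        List.merge (slice (pts s) c w) (slice (pts s) (c + w) w) (leKey κ)) := by
  simp only [mergeRuns, runs_seq, runs_setInt, IExp.eval, hc, IExp.size]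
  simp only [ne_eq, Nat.reduceEqDiff, not_false_eq_true,
    writeInt_int_of_ne, hw, hc, hN]
  set s₁ := ((((s.writeInt 11 0 c).writeInt 11 1 (c + w)).writeInt 11 2 (c + w)).writeInt 11 3
    (c + w + w)).writeInt 11 4 (c + N) with hs₁
  have fr₁ : Frame [11] [10, 11] s s₁ := by
    refine Frame.writeInt (Frame.writeInt (Frame.writeInt (Frame.writeInt (Frame.writeInt
      (Frame.refl s) _ _ ?_) _ _ ?_) _ _ ?_) _ _ ?_) _ _ ?_ <;> simp
  refine (runs_while (2 * w) 60 (fun t s' => Frame [11] [10, 11] s s' ∧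
    (∀ l, ¬ (c + N ≤ l ∧ l < c + N + t) → pts s' l = pts s l) ∧
    s'.int 11 2 = c + w ∧ s'.int 11 3 = c + 2 * w ∧ s'.int 11 4 = c + N + t ∧
    ∃ x y, x + y + t = 2 * w ∧ x ≤ w ∧ y ≤ w ∧ s'.int 11 0 = c + w - x ∧
      s'.int 11 1 = c + 2 * w - y ∧
      slice (pts s') (c + N) t ++ List.merge (slice (pts s) (c + w - x) x)
        (slice (pts s) (c + 2 * w - y) y) (leKey κ) =
      List.merge (slice (pts s) c w) (slice (pts s) (c + w) w) (leKey κ)) ?_ ?_ ?_).mono ?_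
  · rintro t s' ht ⟨fr, hout, h2, h3, h4, x, y, hxy, hx, hy, h0, h1, hm⟩
    constructor
    · simp only [Test.Holds, IExp.eval, h3, h4, fr.int 4, hN]
      omega
    · refine (runs_mergeStep hκ h0 h1 h2 h3 h4).mono ?_
      rintro s'' T ⟨hT, fr', h2', h3', h4', hout', hcase⟩
      refine ⟨hT, fr.trans fr', ?_, h2', h3', by omega, ?_⟩
      · intro l hl
        rw [hout' l (by omega), hout l (by omega)]
      · have hpre : slice (pts s'') (c + N) t = slice (pts s') (c + N) t :=
          slice_congr fun l hl => hout' _ (by omega)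
        have hj : 0 < y → pts s' (c + 2 * w - y) = pts s (c + 2 * w - y) := fun _ =>
          hout _ (by omega)
        rw [hout (c + w - x) (by omega)] at hcase
        rcases hcase with ⟨hlt, hle, h0', h1', ho⟩ | ⟨hle, h0', h1', ho⟩
        · obtain ⟨x, rfl⟩ : ∃ x', x = x' + 1 := ⟨x - 1, by omega⟩
          refine ⟨x, y, by omega, by omega, hy, by omega, h1', ?_⟩
          rw [slice_succ, ho, hpre, ← hm, slice_succ_left (pts s) _ x, List.append_assoc]
          congr 1
          rw [show c + w - (x + 1) + 1 = c + w - x by omega]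
          rcases y with _ | y
          · simp
          · rw [hj (by omega)] at hle
            rw [slice_succ_left (pts s) _ y, List.cons_merge_cons_pos]
            · rfl
            · have : ¬ key κ (pts s (c + 2 * w - (y + 1))) < key κ (pts s (c + w - (x + 1))) :=
                fun h => hle ⟨by omega, h⟩
              simpa [leKey] using this
        · obtain ⟨y, rfl⟩ : ∃ y', y = y' + 1 := by
            refine ⟨y - 1, ?_⟩
            by_contra hy0
            exact hle ⟨by omega, fun h => by omega⟩
          rw [hj (by omega)] at hle ho
          refine ⟨x, y, by omega, hx, by omega, h0', by omega, ?_⟩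
          rw [slice_succ, ho, hpre, ← hm, slice_succ_left (pts s) _ y, List.append_assoc]
          congr 1
          rw [show c + 2 * w - (y + 1) + 1 = c + 2 * w - y by omega]
          rcases x with _ | x
          · simp
          · rw [slice_succ_left (pts s) _ x, List.cons_merge_cons_neg]
            · rfl
            · have : key κ (pts s (c + 2 * w - (y + 1))) < key κ (pts s (c + w - (x + 1))) := by
                by_contra h
                exact hle ⟨by omega, fun h' => h h'.2⟩
              simpa [leKey] using this
  · rintro s' ⟨fr, -, -, h3, h4, -⟩
    simp only [Test.Holds, IExp.eval, h3, h4, fr.int 4, hN]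
    omega
  · refine ⟨fr₁, fun l _ => rfl, by simp [hs₁], by simp [hs₁]; ring, by simp [hs₁], w, w,
      by omega, le_rfl, le_rfl, by simp [hs₁], by simp [hs₁]; omega, ?_⟩
    simp [show c + 2 * w - w = c + w by omega]
  · rintro s' T ⟨hT, fr, hout, -, h3, -, x, y, hxy, hx, hy, -, -, hm⟩
    obtain ⟨rfl, rfl⟩ : x = 0 ∧ y = 0 := by omega
    refine ⟨?_, fr, h3, hout, by simpa using hm⟩
    simp only [Test.size, IExp.size] at hT
    omega

theorem runs_sortLevel {κ : ℕ} (hκ : κ = 10 ∨ κ = 11) {s : State} {w base N u : ℕ}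
    (hw : s.int 10 0 = w) (hw0 : 0 < w) (hb : s.int 7 0 = base) (hN : s.int 4 0 = N)
    (hwN : N = u * (2 * w)) :
    Runs O (sortLevel κ) s fun s' T => T ≤ 200 * N + 50 ∧
      (Frame [10, 11] [10, 11] s s' ∧ s'.int 10 0 = w ∧
      (∀ l < base + N, pts s' l = pts s l) ∧
      ∀ c < u, slice (pts s') (base + N + c * (2 * w)) (2 * w) =
        List.merge (slice (pts s) (base + c * (2 * w)) w)
          (slice (pts s) (base + c * (2 * w) + w) w) (leKey κ)) := by
  simp only [sortLevel, runs_seq, runs_setInt, IExp.eval, hb, IExp.size]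
  simp only [ne_eq, Nat.reduceEqDiff, not_false_eq_true,
    writeInt_int_of_ne, hb, hN]
  set s₁ := (s.writeInt 10 1 base).writeInt 10 2 (base + N) with hs₁
  have fr₁ : Frame [10, 11] [10, 11] s s₁ := by
    refine Frame.writeInt (Frame.writeInt (Frame.refl s) _ _ ?_) _ _ ?_ <;> simp
  refine (runs_while u (70 * (2 * w) + 90) (fun t s' => Frame [10, 11] [10, 11] s s' ∧
    s'.int 10 0 = w ∧ s'.int 10 1 = base + t * (2 * w) ∧ s'.int 10 2 = base + N ∧
    (∀ l < base + N, pts s' l = pts s l) ∧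
      ∀ c < t, slice (pts s') (base + N + c * (2 * w)) (2 * w) =
        List.merge (slice (pts s) (base + c * (2 * w)) w)
          (slice (pts s) (base + c * (2 * w) + w) w) (leKey κ)) ?_ ?_ ?_).mono ?_
  · rintro t s' ht ⟨fr, h0, h1, h2, hout, hm⟩
    have htu : (t + 1) * (2 * w) ≤ N := hwN ▸ Nat.mul_le_mul_right _ ht
    rw [add_mul, one_mul] at htu
    constructor
    · simp only [Test.Holds, IExp.eval, h1, h2]
      omega
    · simp only [runs_seq, runs_setInt, IExp.eval, IExp.size]
      refine (runs_mergeRuns hκ h0 h1 ((congrFun (fr.int 4) 0).trans hN) (by omega)).mono ?_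
      rintro s'' T ⟨hT, fr', h3', hout', hm'⟩
      refine ⟨by omega, (fr.trans (fr'.mono (by simp) (by simp))).writeInt _ _ (by simp),
        ?_, ?_, ?_, ?_, ?_⟩
      · simp [fr'.int 10, h0]
      · simp [h3']; ring
      · simp [fr'.int 10, h2]
      · intro l hl
        rw [pts_writeInt, hout' l (by omega), hout l hl]
      · intro c hc
        rw [pts_writeInt]
        rcases Nat.lt_succ_iff_lt_or_eq.1 hc with hc | rfl
        · rw [← hm c hc]
          have : (c + 1) * (2 * w) ≤ t * (2 * w) := Nat.mul_le_mul_right _ hc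
          rw [add_mul, one_mul] at this
          exact slice_congr fun l hl => hout' _ (by omega)
        · rw [show base + N + c * (2 * w) = base + c * (2 * w) + N by omega, hm']
          congr 1 <;> exact slice_congr fun l hl => hout _ (by omega)
  · rintro s' ⟨-, -, h1, h2, -⟩
    simp only [Test.Holds, IExp.eval, h1, h2]
    omega
  · exact ⟨fr₁, by simp [hs₁, hw], by simp [hs₁], by simp [hs₁], fun l _ => rfl,
      fun c hc => absurd hc (by omega)⟩
  · rintro s' T ⟨hT, fr, h0, -, -, hout, hm⟩
    refine ⟨?_, fr, h0, hout, hm⟩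
    simp only [Test.size, IExp.size] at hT
    have hu : u ≤ N := hwN ▸ Nat.le_mul_of_pos_right u (by omega)
    have : u * (2 + 2 + 1 + (70 * (2 * w) + 90)) = 70 * (u * (2 * w)) + 95 * u := by ring
    rw [← hwN] at this
    simp only [Nat.reduceAdd] at this hT ⊢
    omega

/-- Level `j` of the sort, which starts at position `base + j 2 ^ L`, consists of sorted blocks of
length `2 ^ j`, each of which is a permutation of the block at the same place of the input. -/
theorem runs_sortPhase {κ : ℕ} (hκ : κ = 10 ∨ κ = 11) {s : State} {base L : ℕ}
    (hb : s.int 7 0 = base) (hN : s.int 4 0 = 2 ^ L) :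
    Runs O (sortPhase κ) s fun s' T => T ≤ (L + 1) * (200 * 2 ^ L + 100) ∧
      (Frame [7, 10, 11] [10, 11] s s' ∧ s'.int 7 0 = base + L * 2 ^ L ∧
      (∀ l < base + 2 ^ L, pts s' l = pts s l) ∧
      ∀ j ≤ L, ∀ c < 2 ^ (L - j),
        (slice (pts s') (base + j * 2 ^ L + c * 2 ^ j) (2 ^ j)).Perm
          (slice (pts s) (base + c * 2 ^ j) (2 ^ j)) ∧
        (slice (pts s') (base + j * 2 ^ L + c * 2 ^ j) (2 ^ j)).Pairwise
          fun x y => key κ x ≤ key κ y) := by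
  simp only [sortPhase, runs_seq, runs_setInt, IExp.eval, IExp.size]
  refine (runs_while L (200 * 2 ^ L + 80) (fun t s' => Frame [7, 10, 11] [10, 11] s s' ∧
    s'.int 10 0 = 2 ^ t ∧ s'.int 7 0 = base + t * 2 ^ L ∧
    (∀ l < base + 2 ^ L, pts s' l = pts s l) ∧
      ∀ j ≤ t, ∀ c < 2 ^ (L - j),
        (slice (pts s') (base + j * 2 ^ L + c * 2 ^ j) (2 ^ j)).Perm
          (slice (pts s) (base + c * 2 ^ j) (2 ^ j)) ∧
        (slice (pts s') (base + j * 2 ^ L + c * 2 ^ j) (2 ^ j)).Pairwise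
          fun x y => key κ x ≤ key κ y) ?_ ?_ ?_).mono ?_
  · rintro t s' ht ⟨fr, h0, h7, hout, hlev⟩
    constructor
    · simp only [Test.Holds, IExp.eval, h0, fr.int 4, hN]
      exact Nat.pow_lt_pow_right (by norm_num) ht
    · simp only [runs_seq, runs_setInt, IExp.eval, IExp.size]
      have hsplit : ∀ i ≤ L, 2 ^ L = 2 ^ (L - i) * 2 ^ i := fun i hi => by
        rw [← pow_add, Nat.sub_add_cancel hi]
      have h2t : 2 * 2 ^ t = 2 ^ (t + 1) := by rw [pow_succ, mul_comm]
      have hN' : s'.int 4 0 = 2 ^ L := by rw [fr.int 4, hN]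
      refine (runs_sortLevel (u := 2 ^ (L - (t + 1))) hκ h0 (by positivity) h7 hN'
        (by rw [h2t]; exact hsplit _ ht)).mono ?_
      rintro s'' T ⟨hT, fr', h0', hout', hm⟩
      rw [h2t] at hm
      simp only [ne_eq, Nat.reduceEqDiff, not_false_eq_true,
        writeInt_int_of_ne, h0', fr'.int 7, fr'.int 4, h7, hN']
      refine ⟨by omega, ((fr.trans (fr'.mono (by simp) (by simp))).writeInt _ _
        (by simp)).writeInt _ _ (by simp), ?_, ?_, ?_, ?_⟩
      · simp [pow_succ, mul_two]
      · simp [add_mul, add_assoc]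
      · intro l hl
        rw [pts_writeInt, pts_writeInt, hout' l (by omega), hout l hl]
      · intro j hj c hc
        rw [pts_writeInt, pts_writeInt]
        rcases Nat.lt_succ_iff_lt_or_eq.1 (Nat.lt_succ_of_le hj) with hj | rfl
        · have hj : j ≤ t := Nat.le_of_lt_succ hj
          have hcj : (c + 1) * 2 ^ j ≤ 2 ^ L := by
            rw [hsplit j (by omega)]; exact Nat.mul_le_mul_right _ hc
          have hjt : j * 2 ^ L ≤ t * 2 ^ L := Nat.mul_le_mul_right _ hj
          rw [add_mul, one_mul] at hcj
          rw [slice_congr (Z' := pts s') (i' := base + j * 2 ^ L + c * 2 ^ j)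
            fun l hl => hout' _ (by omega)]
          exact hlev j hj c hc
        · have hidx : base + (t + 1) * 2 ^ L + c * 2 ^ (t + 1) =
              base + t * 2 ^ L + 2 ^ L + c * 2 ^ (t + 1) := by ring
          have hL : 2 ^ (L - t) = 2 * 2 ^ (L - (t + 1)) := by
            rw [← pow_succ']; congr 1; omega
          obtain ⟨p1, q1⟩ := hlev t le_rfl (2 * c) (by omega)
          obtain ⟨p2, q2⟩ := hlev t le_rfl (2 * c + 1) (by omega)
          have e1 : 2 * c * 2 ^ t = c * 2 ^ (t + 1) := by rw [pow_succ]; ring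
          have e2 : (2 * c + 1) * 2 ^ t = c * 2 ^ (t + 1) + 2 ^ t := by rw [pow_succ]; ring
          rw [e1] at p1 q1
          rw [e2, ← add_assoc] at p2 q2
          rw [hidx, hm c hc]
          constructor
          · refine (List.merge_perm_append (le := leKey κ)).trans ?_
            rw [show 2 ^ (t + 1) = 2 ^ t + 2 ^ t by rw [pow_succ, mul_two], slice_add,
              ← mul_two (2 ^ t), ← pow_succ]
            refine List.Perm.append p1 ?_
            rwa [add_assoc base (c * _)]
          · have := List.pairwise_merge (le := leKey κ)
              (fun a b c hab hbc => by
                simp only [leKey, decide_eq_true_eq] at *; exact hab.trans hbc)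
              (fun a b => by
                simp only [leKey, Bool.or_eq_true, decide_eq_true_eq]; exact le_total _ _)
              _ _ (by simpa [leKey] using q1) (by simpa [leKey] using q2)
            simpa [leKey] using this
  · rintro s' ⟨fr, h0, -⟩
    simp only [Test.Holds, IExp.eval, h0, fr.int 4, hN]
    omega
  · refine ⟨(Frame.refl s).writeInt _ _ (by simp), by simp, by simp [hb], fun l _ => rfl, ?_⟩
    intro j hj c hc
    obtain rfl : j = 0 := by omega
    rw [pts_writeInt]
    simp [slice]
  · rintro s' T ⟨hT, fr, -, h7, hout, hlev⟩
    refine ⟨?_, fr, h7, hout, hlev⟩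
    simp only [Test.size, IExp.size] at hT
    have : (L + 1) * (200 * 2 ^ L + 100) =
        L * (1 + 1 + (1 + 1) + 1 + (200 * 2 ^ L + 80)) + 15 * L + (200 * 2 ^ L + 100) := by ring
    omega

end MergeSort

/-! ### The candidate translations -/

/-- The state `s` still holds the input. -/
def HoldsInput {m n : ℕ} (a : Fin m → Plane) (b : Fin n → Plane) (k : ℕ) (ε : ℝ) (s : State) :
    Prop :=
  s.int 0 = (input a b k ε).int 0 ∧ ∀ r < 5, s.real r = (input a b k ε).real r

section HoldsInput

variable {m n : ℕ} {a : Fin m → Plane} {b : Fin n → Plane} {k : ℕ} {ε : ℝ} {s : State}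

theorem HoldsInput.frame (h : HoldsInput a b k ε s) {I R : List ℕ} {s' : State}
    (hf : Frame I R s s') (hI : 0 ∉ I := by decide) (hR : ∀ r < 5, r ∉ R := by decide) :
    HoldsInput a b k ε s' :=
  ⟨(hf.1 0 hI).trans h.1, fun r hr => (hf.2 r (hR r hr)).trans (h.2 r hr)⟩

theorem HoldsInput.int_m (h : HoldsInput a b k ε s) : s.int 0 0 = m := by
  rw [h.1]; simp [input]

theorem HoldsInput.int_n (h : HoldsInput a b k ε s) : s.int 0 1 = n := by
  rw [h.1]; simp [input]

theorem HoldsInput.int_k (h : HoldsInput a b k ε s) : s.int 0 2 = k := by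
  rw [h.1]; simp [input]

theorem HoldsInput.real_a0 (h : HoldsInput a b k ε s) (i : Fin m) : s.real 0 i = a i 0 := by
  rw [h.2 0 (by simp)]; simp [input]

theorem HoldsInput.real_a1 (h : HoldsInput a b k ε s) (i : Fin m) : s.real 1 i = a i 1 := by
  rw [h.2 1 (by simp)]; simp [input]

theorem HoldsInput.real_b0 (h : HoldsInput a b k ε s) (j : Fin n) : s.real 2 j = b j 0 := by
  rw [h.2 2 (by simp)]; simp [input]

theorem HoldsInput.real_b1 (h : HoldsInput a b k ε s) (j : Fin n) : s.real 3 j = b j 1 := by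
  rw [h.2 3 (by simp)]; simp [input]

theorem HoldsInput.real_eps (h : HoldsInput a b k ε s) : s.real 4 0 = ε := by
  rw [h.2 4 (by simp)]; simp [input]

end HoldsInput

/-- Write all difference vectors `b j - a i` to the real arrays `10` and `11`, and their number to
the integer array `3`. -/
def fillDifferences : Program :=
  .seq (setI 8 0 (.const 0))
    (.while (.ltInt (iv 8 0) (iv 0 0))
      (.seq (setI 8 1 (.const 0))
        (.seq
          (.while (.ltInt (iv 8 1) (iv 0 1))
            (.seq (.setReal 10 (iv 3 0) (.sub (.read 2 (iv 8 1)) (.read 0 (iv 8 0))))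
              (.seq (.setReal 11 (iv 3 0) (.sub (.read 3 (iv 8 1)) (.read 1 (iv 8 0))))
                (.seq (incr 3 0) (incr 8 1)))))
          (incr 8 0))))

/-- Compute a power `2 ^ L` that is at least the number of differences, and the number `4 L + 2`;
they are stored in the integer arrays `4` and `5`. -/
def computePower : Program :=
  .seq (setI 4 0 (.const 1))
    (.seq (setI 5 0 (.const 2))
      (.while (.ltInt (iv 4 0) (iv 3 0))
        (.seq (setI 4 0 (.add (iv 4 0) (iv 4 0))) (setI 5 0 (.add (iv 5 0) (.const 4))))))

/-- Compute the smallest `σ ≥ 1` with `k ≤ σ (4 L + 2)`; it is stored in the integer array `6`. -/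
def computeStride : Program :=
  .seq (setI 6 0 (.const 1))
    (.seq (setI 9 0 (iv 5 0))
      (.while (.ltInt (iv 9 0) (iv 0 2))
        (.seq (setI 9 0 (.add (iv 9 0) (iv 5 0))) (incr 6 0))))

/-- All preparations: afterwards the candidate translations are the points whose positions are
divisible by the stride. -/
def prepare : Program :=
  .seq fillDifferences
    (.seq computePower (.seq computeStride (.seq (sortPhase 10) (sortPhase 11))))

section Prepare

variable {p : ℝ≥0∞} {O : StationarySolver p} {m n : ℕ} {a : Fin m → Plane} {b : Fin n → Plane}
  {k : ℕ} {ε : ℝ} {s : State}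

/-- The first `q` differences are stored. -/
def Filled (a : Fin m → Plane) (b : Fin n → Plane) (q : ℕ) (s : State) : Prop :=
  ∀ (i : Fin m) (j : Fin n), (i : ℕ) * n + j < q →
    pts s (i * n + j) = (b j 0 - a i 0, b j 1 - a i 1)

theorem eq_and_eq_of_mul_add_eq {n i i' j j' : ℕ} (hj : j < n) (hj' : j' < n)
    (h : i * n + j = i' * n + j') : i = i' ∧ j = j' := by
  have hn : 0 < n := by omega
  have h1 := congrArg (· / n) h
  have h2 := congrArg (· % n) h
  simp only [Nat.mul_add_mod_of_lt hj, Nat.mul_add_mod_of_lt hj'] at h2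
  rw [mul_comm i, mul_comm i'] at h1
  simp only [Nat.mul_add_div hn, Nat.div_eq_of_lt hj, Nat.div_eq_of_lt hj', add_zero] at h1
  exact ⟨h1, h2⟩

theorem Filled.step {q : ℕ} {s' : State} (h : Filled a b q s) (i : Fin m) (j : Fin n)
    (hq : q = i * n + j) (hout : ∀ l, l ≠ q → pts s' l = pts s l)
    (hnew : pts s' q = (b j 0 - a i 0, b j 1 - a i 1)) : Filled a b (q + 1) s' := by
  intro i' j' hlt
  by_cases heq : (i' : ℕ) * n + j' = q
  · obtain ⟨hi, hj⟩ := eq_and_eq_of_mul_add_eq j'.2 j.2 (heq.trans hq)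
    rw [heq, hnew, Fin.ext hi, Fin.ext hj]
  · rw [hout _ heq]
    exact h i' j' (by omega)

theorem runs_fillDifferences (hs : HoldsInput a b k ε s) (h3 : s.int 3 0 = 0) (hn : 1 ≤ n) :
    Runs O fillDifferences s fun s' T => T ≤ 100 * (m * n) + 20 ∧
      (Frame [3, 8] [10, 11] s s' ∧ s'.int 3 0 = m * n ∧ Filled a b (m * n) s') := by
  simp only [fillDifferences, runs_seq, runs_setInt, IExp.eval, IExp.size]
  refine (runs_while m (43 * n + 30) (fun t s' => Frame [3, 8] [10, 11] s s' ∧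
    s'.int 8 0 = t ∧ s'.int 3 0 = t * n ∧ Filled a b (t * n) s') ?_ ?_ ?_).mono ?_
  · rintro t s₁ ht ⟨fr, h0, h3, hfill⟩
    have hi := hs.frame fr
    refine ⟨by simp [h0, hi.int_m, ht], ?_⟩
    simp only [runs_seq, runs_setInt, IExp.eval, IExp.size]
    refine (runs_while n 36 (fun u s' => Frame [3, 8] [10, 11] s s' ∧
      s'.int 8 0 = t ∧ s'.int 8 1 = u ∧ s'.int 3 0 = t * n + u ∧ Filled a b (t * n + u) s')
        ?_ ?_ ?_).mono ?_
    · rintro u s₂ hu ⟨fr, h0, h1, h3, hfill⟩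
      have hi := hs.frame fr
      refine ⟨by simp [h1, hi.int_n, hu], ?_⟩
      simp only [runs_seq, runs_setInt, runs_setReal, IExp.eval, RExp.eval, IExp.size, RExp.size]
      refine ⟨by simp, ?_, by simp [h0], by simp [h1], by simp [h3, add_assoc], ?_⟩
      · refine (((fr.writeReal _ _ ?_).writeReal _ _ ?_).writeInt _ _ ?_).writeInt _ _ ?_ <;> simp
      · rw [← add_assoc]
        refine hfill.step ⟨t, ht⟩ ⟨u, hu⟩ rfl ?_ ?_
        · intro l hl
          simp [pts, h3, hl]
        · have e0 := hi.real_a0 ⟨t, ht⟩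
          have e1 := hi.real_a1 ⟨t, ht⟩
          have e2 := hi.real_b0 ⟨u, hu⟩
          have e3 := hi.real_b1 ⟨u, hu⟩
          simp only at e0 e1 e2 e3
          simp [pts, h3, h0, h1, e0, e1, e2, e3]
    · rintro s₂ ⟨fr, -, h1, -⟩
      simp [h1, (hs.frame fr).int_n]
    · exact ⟨fr.writeInt _ _ (by simp), by simp [h0], by simp, by simp [h3], hfill⟩
    · rintro s₂ T ⟨hT, fr, h0, h1, h3, hfill⟩
      simp only [Test.size, IExp.size] at hT
      refine ⟨by omega, fr.writeInt _ _ (by simp), by simp [h0], ?_, ?_⟩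
      · simp [h3]; ring
      · rw [add_mul, one_mul]; exact hfill
  · rintro s₁ ⟨fr, h0, -⟩
    simp [h0, (hs.frame fr).int_m]
  · refine ⟨(Frame.refl s).writeInt _ _ (by simp), by simp, by simp [h3], ?_⟩
    intro i j h
    omega
  · rintro s₁ T ⟨hT, fr, -, h3, hfill⟩
    refine ⟨?_, fr, h3, hfill⟩
    simp only [Test.size, IExp.size] at hT
    have h1 : m ≤ m * n := Nat.le_mul_of_pos_right m hn
    have h2 : m * (2 + 2 + 1 + (43 * n + 30)) = 43 * (m * n) + 35 * m := by ring
    rw [h2] at hT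
    omega

theorem runs_computePower {N : ℕ} (h3 : s.int 3 0 = N) :
    Runs O computePower s fun s' T => T ≤ 25 * Nat.clog 2 N + 20 ∧
      (Frame [4, 5] [] s s' ∧ s'.int 4 0 = 2 ^ Nat.clog 2 N ∧
        s'.int 5 0 = 4 * Nat.clog 2 N + 2) := by
  simp only [computePower, runs_seq, runs_setInt, IExp.eval, IExp.size]
  refine (runs_while (Nat.clog 2 N) 18 (fun t s' => Frame [4, 5] [] s s' ∧
    s'.int 4 0 = 2 ^ t ∧ s'.int 5 0 = 4 * t + 2) ?_ ?_ ?_).mono ?_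
  · rintro t s₁ ht ⟨fr, h4, h5⟩
    constructor
    · simp only [Test.Holds, IExp.eval, h4, fr.int 3, h3]
      exact (Nat.lt_clog_iff_pow_lt (by norm_num)).1 ht
    · simp only [runs_seq, runs_setInt, IExp.eval, IExp.size]
      refine ⟨by simp, (fr.writeInt _ _ (by simp)).writeInt _ _ (by simp), ?_, ?_⟩
      · simp [h4, pow_succ, mul_two]
      · simp [h5]; ring
  · rintro s₁ ⟨fr, h4, -⟩
    simp only [Test.Holds, IExp.eval, h4, fr.int 3, h3, not_lt]
    exact Nat.le_pow_clog (by norm_num) N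
  · exact ⟨((Frame.refl s).writeInt _ _ (by simp)).writeInt _ _ (by simp), by simp, by simp⟩
  · rintro s₁ T ⟨hT, h⟩
    simp only [Test.size, IExp.size] at hT
    exact ⟨by omega, h⟩

theorem runs_computeStride {d : ℕ} (hs : HoldsInput a b k ε s) (h5 : s.int 5 0 = d) (hd : 0 < d)
    (hk : 1 ≤ k) :
    Runs O computeStride s fun s' T => T ≤ 25 * k + 20 ∧
      (Frame [6, 9] [] s s' ∧
        ∃ σ, s'.int 6 0 = σ ∧ 1 ≤ σ ∧ k ≤ d * σ ∧ d * (σ - 1) < k) := by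
  simp only [computeStride, runs_seq, runs_setInt, IExp.eval, IExp.size]
  refine (runs_while ((k - 1) / d) 18 (fun t s' => Frame [6, 9] [] s s' ∧
    s'.int 6 0 = t + 1 ∧ s'.int 9 0 = d * (t + 1)) ?_ ?_ ?_).mono ?_
  · rintro t s₁ ht ⟨fr, h6, h9⟩
    constructor
    · simp only [Test.Holds, IExp.eval, h9, (hs.frame fr).int_k]
      have := (Nat.le_div_iff_mul_le hd).1 (Nat.succ_le_of_lt ht)
      rw [Nat.succ_eq_add_one, mul_comm] at this
      omega
    · simp only [runs_seq, runs_setInt, IExp.eval, IExp.size]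
      refine ⟨by simp, (fr.writeInt _ _ (by simp)).writeInt _ _ (by simp), ?_, ?_⟩
      · simp [h6]
      · simp [h9, fr.int 5, h5]; ring
  · rintro s₁ ⟨fr, -, h9⟩
    simp only [Test.Holds, IExp.eval, h9, (hs.frame fr).int_k, not_lt]
    have := Nat.lt_mul_div_succ (k - 1) hd
    omega
  · exact ⟨((Frame.refl s).writeInt _ _ (by simp)).writeInt _ _ (by simp), by simp, by simp [h5]⟩
  · rintro s₁ T ⟨hT, fr, h6, -⟩
    simp only [Test.size, IExp.size] at hT
    have h1 : (k - 1) / d ≤ k := (Nat.div_le_self _ _).trans (by omega)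
    have h2 := Nat.lt_mul_div_succ (k - 1) hd
    have h3 := Nat.mul_div_le (k - 1) d
    refine ⟨by omega, fr, _, h6, by omega, by omega, ?_⟩
    rw [Nat.add_sub_cancel]
    omega

/-- After the preparations, every box that contains the differences of at least `k / 2` pairs of
indices contains a candidate translation. -/
theorem runs_prepare (hs : HoldsInput a b k ε s) (h3 : s.int 3 0 = 0) (h7 : s.int 7 0 = 0)
    (hk : 1 ≤ k) (hkm : k ≤ m) (hn : 1 ≤ n) {L : ℕ} (hL : L = Nat.clog 2 (m * n)) :
    Runs O prepare s fun s' T => T ≤ 125 * (m * n) + 2 * ((L + 1) * (200 * 2 ^ L + 100)) +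
        25 * L + 60 ∧
      (Frame [3, 4, 5, 6, 7, 8, 9, 10, 11] [10, 11] s s' ∧ s'.int 4 0 = 2 ^ L ∧
        s'.int 7 0 = 2 * L * 2 ^ L ∧
        ∃ σ, s'.int 6 0 = σ ∧ 1 ≤ σ ∧ k ≤ (4 * L + 2) * σ ∧
          ∀ (F : Finset (Fin m × Fin n)) (x₁ x₂ y₁ y₂ : ℝ), k ≤ 2 * F.card →
            (∀ e ∈ F, (x₁ ≤ b e.2 0 - a e.1 0 ∧ b e.2 0 - a e.1 0 ≤ x₂) ∧
              (y₁ ≤ b e.2 1 - a e.1 1 ∧ b e.2 1 - a e.1 1 ≤ y₂)) →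
            ∃ q < (2 * L + 1) * 2 ^ L, σ ∣ q ∧
              (x₁ ≤ (pts s' q).1 ∧ (pts s' q).1 ≤ x₂) ∧
              (y₁ ≤ (pts s' q).2 ∧ (pts s' q).2 ≤ y₂)) := by
  classical
  have hkmn : k ≤ m * n := hkm.trans (Nat.le_mul_of_pos_right m hn)
  refine Runs.of_le (B := (100 * (m * n) + 20) + ((25 * L + 20) + ((25 * k + 20) +
    ((L + 1) * (200 * 2 ^ L + 100) + (L + 1) * (200 * 2 ^ L + 100))))) ?_ (by omega)
  refine Runs.seq (runs_fillDifferences hs h3 hn) ?_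
  rintro s₁ ⟨fr₁, hN, hfill⟩
  refine Runs.seq (hL ▸ runs_computePower hN) ?_
  rintro s₂ ⟨fr₂, h4, h5⟩
  have fr₂' : Frame [3, 4, 5, 8] [10, 11] s s₂ :=
    (fr₁.mono (by simp) (by simp)).trans (fr₂.mono (by simp) (by simp))
  refine Runs.seq (runs_computeStride (hs.frame fr₂') h5 (by omega) hk) ?_
  rintro s₃ ⟨fr₃, σ, h6, hσ, hkσ, hσk⟩
  have fr₃' : Frame [3, 4, 5, 6, 8, 9] [10, 11] s s₃ :=
    (fr₂'.mono (by simp) (by simp)).trans (fr₃.mono (by simp) (by simp))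
  refine Runs.seq (runs_sortPhase (κ := 10) (Or.inl rfl) ((congrFun (fr₃'.int 7) 0).trans h7)
    ((congrFun (fr₃.int 4) 0).trans h4)) ?_
  rintro s₄ ⟨fr₄, h7₄, hout₄, hlev₄⟩
  refine (runs_sortPhase (κ := 11) (Or.inr rfl) h7₄ (((congrFun (fr₄.int 4) 0).trans
    (congrFun (fr₃.int 4) 0)).trans h4)).mono ?_
  rintro s₅ T ⟨hT, fr₅, h7₅, hout₅, hlev₅⟩
  refine ⟨hT, ?_, ?_, ?_, σ, ?_, hσ, hkσ, ?_⟩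
  · exact ((fr₃'.mono (by simp) (by simp)).trans (fr₄.mono (by simp) (by simp))).trans
      (fr₅.mono (by simp) (by simp))
  · rw [fr₅.int 4, fr₄.int 4, fr₃.int 4, h4]
  · rw [h7₅]; ring
  · rw [fr₅.int 6, fr₄.int 6, h6]
  · intro F x₁ x₂ y₁ y₂ hF hbox
    have hpts : pts s₃ = pts s₁ := by
      funext l
      exact pts_eq_of_real (by rw [fr₃.real 10, fr₂.real 10]) (by rw [fr₃.real 11, fr₂.real 11])
    have hmn : m * n ≤ 2 ^ L := hL ▸ Nat.le_pow_clog (by norm_num) _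
    have hcount : (2 * L + 1) * (σ - 1) < (slice (pts s₃) 0 (2 ^ L)).countP
        fun z => (x₁ ≤ z.1 ∧ z.1 ≤ x₂) ∧ (y₁ ≤ z.2 ∧ z.2 ≤ y₂) := by
      have hcard : F.card ≤ (slice (pts s₃) 0 (2 ^ L)).countP
          fun z => (x₁ ≤ z.1 ∧ z.1 ≤ x₂) ∧ (y₁ ≤ z.2 ∧ z.2 ≤ y₂) := by
        rw [countP_slice]
        refine Finset.card_le_card_of_injOn (fun e => (e.1 : ℕ) * n + e.2) ?_ ?_
        · intro e he
          have hlt : (e.1 : ℕ) * n + e.2 < m * n := by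
            have := Nat.mul_le_mul_right n (Nat.succ_le_of_lt e.1.2)
            rw [Nat.succ_mul] at this
            have := e.2.2
            omega
          simp only [Finset.coe_filter, Finset.mem_range, Set.mem_ofPred_eq, zero_add,
            decide_eq_true_eq, hpts, hfill e.1 e.2 hlt]
          exact ⟨hlt.trans_le hmn, hbox e he⟩
        · intro e _ e' _ h
          obtain ⟨h1, h2⟩ := eq_and_eq_of_mul_add_eq e.2.2 e'.2.2 h
          exact Prod.ext (Fin.ext h1) (Fin.ext h2)
      have : (4 * L + 2) * (σ - 1) = 2 * ((2 * L + 1) * (σ - 1)) := by ring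
      omega
    simp only [zero_add] at h7₄ hlev₄ hout₄ hout₅ hlev₅
    obtain ⟨hp, hsrt⟩ := hlev₄ L le_rfl 0 (by simp)
    simp only [zero_mul, add_zero] at hp hsrt
    have hsame : slice (pts s₅) (L * 2 ^ L) (2 ^ L) = slice (pts s₄) (L * 2 ^ L) (2 ^ L) :=
      slice_congr fun l hl => hout₅ _ (by omega)
    obtain ⟨q, hq, h⟩ := exists_mem_box (pts s₅) _ L (L * 2 ^ L) σ hσ (hsame ▸ hp)
      (by rw [hsame]; simpa [key] using hsrt) (by
        intro j hj c hc
        obtain ⟨h1, h2⟩ := hlev₅ j hj c hc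
        refine ⟨?_, by simpa [key] using h2⟩
        rwa [slice_congr (Z := pts s₅) (Z' := pts s₄) (i := L * 2 ^ L + c * 2 ^ j)
          (i' := L * 2 ^ L + c * 2 ^ j) fun l hl => hout₅ _ ?_]
        have h3 : (c + 1) * 2 ^ j ≤ 2 ^ (L - j) * 2 ^ j := Nat.mul_le_mul_right _ hc
        rw [← pow_add, Nat.sub_add_cancel hj, add_mul, one_mul] at h3
        omega) x₁ x₂ y₁ y₂ hcount
    refine ⟨q, hq.trans_eq (by ring), h⟩

end Prepare

/-! ### Evaluation of a translation -/

/-- Write the translated points of the first set to the real arrays `7` and `8`. The translation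
vector is stored in the real array `13`. -/
def translatePoints : Program :=
  .seq (setI 14 0 (.const 0))
    (.while (.ltInt (iv 14 0) (iv 0 0))
      (.seq (.setReal 7 (iv 14 0) (.add (.read 0 (iv 14 0)) (rv 13 0)))
        (.seq (.setReal 8 (iv 14 0) (.add (.read 1 (iv 14 0)) (rv 13 1))) (incr 14 0))))

/-- Query the black box for the translated points. The answer is written to the integer arrays `12`
and `13`. -/
def queryMatching : Program :=
  .query 7 8 2 3 (iv 0 0) (iv 0 1) (iv 0 2) (.div (rv 4 0) (.const 2)) 12 13

/-- The length of the current edge of the answer of the black box. -/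
def edgeLength : RExp :=
  .sqrt (.add
    (.mul (.sub (.read 7 (.read 12 (iv 14 0))) (.read 2 (.read 13 (iv 14 0))))
      (.sub (.read 7 (.read 12 (iv 14 0))) (.read 2 (.read 13 (iv 14 0)))))
    (.mul (.sub (.read 8 (.read 12 (iv 14 0))) (.read 3 (.read 13 (iv 14 0))))
      (.sub (.read 8 (.read 12 (iv 14 0))) (.read 3 (.read 13 (iv 14 0))))))

/-- The maximum of two reals `x`, `y`, computed as `(x + y + √((x - y)²)) / 2`. -/
def maxExp (e f : RExp) : RExp :=
  .div (.add (.add e f) (.sqrt (.mul (.sub e f) (.sub e f)))) (.const 2)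

open scoped Classical in
/-- The update of the accumulated cost in cell `0` of the real array `9`. -/
noncomputable def accExp (p : ℝ≥0∞) : RExp :=
  if p = ∞ then maxExp (rv 9 0) edgeLength else .add (rv 9 0) (.pow edgeLength)

open scoped Classical in
/-- The cost as a function of the accumulated cost. -/
noncomputable def finalExp (p : ℝ≥0∞) : RExp :=
  if p = ∞ then rv 9 0 else .root (.div (rv 9 0) (.ofInt (iv 0 2)))

/-- Compute the cost of the answer of the black box in cell `0` of the real array `9`. -/
noncomputable def computeCost (p : ℝ≥0∞) : Program :=
  .seq (setR 9 0 (.const 0))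
    (.seq (setI 14 0 (.const 0))
      (.seq (.while (.ltInt (iv 14 0) (iv 0 2)) (.seq (setR 9 0 (accExp p)) (incr 14 0)))
        (setR 9 0 (finalExp p))))

/-- Save the translation vector, the matching, and its cost; the latter goes to the real array `6`.
The integer array `15` holds a flag that shows that something has been saved. -/
def save : Program :=
  .seq (setR 6 0 (rv 9 0))
    (.seq (setR 5 0 (rv 13 0))
      (.seq (setR 5 1 (rv 13 1))
        (.seq (setI 15 0 (.const 1))
          (.seq (setI 14 0 (.const 0))
            (.while (.ltInt (iv 14 0) (iv 0 2))
              (.seq (.setInt 1 (iv 14 0) (.read 12 (iv 14 0)))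
                (.seq (.setInt 2 (iv 14 0) (.read 13 (iv 14 0))) (incr 14 0))))))))

/-- Evaluate the translation in the real array `13`, and save it if it is the best one so far. -/
noncomputable def tryTranslation (p : ℝ≥0∞) : Program :=
  .seq translatePoints
    (.seq queryMatching
      (.seq (computeCost p)
        (.ite (.neg (.conj (.neg (.ltInt (iv 15 0) (.const 1)))
          (.neg (.ltReal (rv 9 0) (rv 6 0))))) save .skip)))

section Try

variable {p : ℝ≥0∞} {O : StationarySolver p} {m n : ℕ} {a : Fin m → Plane} {b : Fin n → Plane}
  {k : ℕ} {ε : ℝ} {s : State}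

theorem runs_translatePoints (hs : HoldsInput a b k ε s) :
    Runs O translatePoints s fun s' T => T ≤ 40 * m + 20 ∧
      (Frame [14] [7, 8] s s' ∧ ∀ i : Fin m, s'.real 7 i = a i 0 + s.real 13 0 ∧
        s'.real 8 i = a i 1 + s.real 13 1) := by
  simp only [translatePoints, runs_seq, runs_setInt, IExp.eval, IExp.size]
  refine (runs_while m 28 (fun t s' => Frame [14] [7, 8] s s' ∧ s'.int 14 0 = t ∧
    ∀ i : Fin m, (i : ℕ) < t → s'.real 7 i = a i 0 + s.real 13 0 ∧
      s'.real 8 i = a i 1 + s.real 13 1) ?_ ?_ ?_).mono ?_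
  · rintro t s₁ ht ⟨fr, h0, hdone⟩
    have hi := hs.frame fr
    refine ⟨by simp [h0, hi.int_m, ht], ?_⟩
    simp only [runs_seq, runs_setInt, runs_setReal, IExp.eval, RExp.eval, IExp.size, RExp.size]
    refine ⟨by simp, ?_, by simp [h0], ?_⟩
    · refine ((fr.writeReal _ _ ?_).writeReal _ _ ?_).writeInt _ _ ?_ <;> simp
    · intro i hlt
      by_cases hit : (i : ℕ) = t
      · have e0 := hi.real_a0 i
        have e1 := hi.real_a1 i
        rw [hit] at e0 e1
        simp [h0, hit, e0, e1, fr.real 13]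
      · simpa [h0, hit] using hdone i (by omega)
  · rintro s₁ ⟨fr, h0, -⟩
    simp [h0, (hs.frame fr).int_m]
  · exact ⟨(Frame.refl s).writeInt _ _ (by simp), by simp, fun i h => absurd h (by omega)⟩
  · rintro s₁ T ⟨hT, fr, -, hdone⟩
    simp only [Test.size, IExp.size] at hT
    exact ⟨by omega, fr, fun i => hdone i i.2⟩

theorem maxExp_eval (e f : RExp) (s : State) :
    (maxExp e f).eval p s = max (e.eval p s) (f.eval p s) := by
  simp only [maxExp, RExp.eval, Real.sqrt_mul_self_eq_abs, Rat.cast_ofNat]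
  rcases le_total (e.eval p s) (f.eval p s) with h | h
  · rw [max_eq_right h, abs_of_nonpos (sub_nonpos.2 h)]; ring
  · rw [max_eq_left h, abs_of_nonneg (sub_nonneg.2 h)]; ring

theorem norm_eq_sqrt (x : Plane) : ‖x‖ = Real.sqrt (x 0 * x 0 + x 1 * x 1) := by
  rw [EuclideanSpace.norm_eq, Fin.sum_univ_two]
  simp [pow_two]

theorem accExp_size_le (p : ℝ≥0∞) : (accExp p).size ≤ 150 := by
  unfold accExp
  split_ifs <;> simp [maxExp, edgeLength]

theorem finalExp_size_le (p : ℝ≥0∞) : (finalExp p).size ≤ 10 := by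
  unfold finalExp
  split_ifs <;> simp

theorem runs_computeCost (hs : HoldsInput a b k ε s) {t : Plane}
    (h7 : ∀ i : Fin m, s.real 7 i = a i 0 + t 0 ∧ s.real 8 i = a i 1 + t 1)
    {M : Finset (Plane × Plane)} (hM : Encodes a b k (fun l => (s.int 12 l, s.int 13 l)) M)
    (hcard : M.card = k) :
    Runs O (computeCost p) s fun s' T => T ≤ 170 * k + 40 ∧
      (Frame [14] [9] s s' ∧ s'.real 9 0 = matchCost p M t) := by
  obtain ⟨i, j, hij, hM⟩ := hM
  simp only [Prod.mk.injEq] at hij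
  set len : ℕ → ℝ := fun l => if h : l < k then ‖a (i ⟨l, h⟩) + t - b (j ⟨l, h⟩)‖ else 0 with hlen
  have hlen0 : ∀ l, 0 ≤ len l := fun l => by
    simp only [hlen]; split_ifs <;> simp
  rw [matchCost_eq_costAcc hM hcard t len fun l => by simp [hlen]]
  simp only [computeCost, runs_seq, runs_setInt, runs_setReal, IExp.eval, RExp.eval, IExp.size,
    RExp.size]
  have hacc := accExp_size_le p
  have hfin := finalExp_size_le p
  refine (runs_while k 158 (fun u s' => Frame [14] [9] s s' ∧ s'.int 14 0 = u ∧
    s'.real 9 0 = costAcc p len u) ?_ ?_ ?_).mono ?_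
  · rintro u s₁ hu ⟨fr, h0, h9⟩
    have hi := hs.frame fr
    refine ⟨by simp [h0, hi.int_k, hu], ?_⟩
    simp only [runs_seq, runs_setInt, runs_setReal, IExp.eval, IExp.size]
    refine ⟨by omega, (fr.writeReal _ _ (by simp)).writeInt _ _ (by simp), by simp [h0], ?_⟩
    have hedge : edgeLength.eval p s₁ = len u := by
      have e1 := hij ⟨u, hu⟩
      have e2 := h7 (i ⟨u, hu⟩)
      have e3 := hi.real_b0 (j ⟨u, hu⟩)
      have e4 := hi.real_b1 (j ⟨u, hu⟩)
      simp only at e1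
      simp [edgeLength, hlen, hu, h0, fr.int 12, fr.int 13, e1, fr.real 7, fr.real 8, e2, e3, e4,
        norm_eq_sqrt]
    simp only [writeInt_real, writeReal_real_self, if_true]
    rw [costAcc, accExp]
    split_ifs
    · rw [maxExp_eval, hedge]
      simp [h9]
    · simp [hedge, h9, abs_of_nonneg (hlen0 u)]
  · rintro s₁ ⟨fr, h0, -⟩
    simp [h0, (hs.frame fr).int_k]
  · exact ⟨((Frame.refl s).writeReal _ _ (by simp)).writeInt _ _ (by simp), by simp,
      by simp [costAcc]⟩
  · rintro s₁ T ⟨hT, fr, -, h9⟩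
    simp only [Test.size, IExp.size] at hT
    refine ⟨by omega, fr.writeReal _ _ (by simp), ?_⟩
    have hnn : 0 ≤ costAcc p len k / k := div_nonneg (costAcc_nonneg hlen0 k) (Nat.cast_nonneg k)
    simp only [finalExp]
    split_ifs
    · simp [h9]
    · simp only [RExp.eval, IExp.eval, h9, (hs.frame fr).int_k, writeReal_real_self, if_true,
        abs_of_nonneg hnn]

/-- A valid matching together with its translation vector and its cost is saved. -/
def Saved (p : ℝ≥0∞) (a : Fin m → Plane) (b : Fin n → Plane) (k : ℕ) (s : State) : Prop :=
  ∃ M, Encodes a b k s.outPairs M ∧ IsKMatching (pointSet a) (pointSet b) k M ∧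
    matchCost p M s.outVector = s.real 6 0

/-- If the flag in the integer array `15` is set, then the saved solution is valid. If `C` is nonempty,
then the flag is set, and for every translation in `C` the saved cost is at most the cost that the
black box guarantees for this translation. -/
def Tested (p : ℝ≥0∞) (a : Fin m → Plane) (b : Fin n → Plane) (k : ℕ) (ε : ℝ) (C : Set Plane)
    (s : State) : Prop :=
  (1 ≤ s.int 15 0 → Saved p a b k s) ∧
    ∀ t ∈ C, 1 ≤ s.int 15 0 ∧
      s.real 6 0 ≤ (1 + ε / 2) * optCost p (pointSet a) (pointSet b) k t

theorem Saved.frame {I R : List ℕ} {s' : State} (h : Saved p a b k s) (hf : Frame I R s s')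
    (h1 : 1 ∉ I := by decide) (h2 : 2 ∉ I := by decide) (h5 : 5 ∉ R := by decide)
    (h6 : 6 ∉ R := by decide) : Saved p a b k s' := by
  obtain ⟨M, h⟩ := h
  have hp : s'.outPairs = s.outPairs := by
    funext l
    simp only [State.outPairs, hf.1 1 h1, hf.1 2 h2]
  have hv : s'.outVector = s.outVector := by
    simp only [State.outVector, hf.2 5 h5]
  exact ⟨M, by rwa [hp, hv, hf.2 6 h6]⟩

theorem Tested.frame {I R : List ℕ} {s' : State} {C : Set Plane} (h : Tested p a b k ε C s)
    (hf : Frame I R s s') (h1 : 1 ∉ I := by decide) (h2 : 2 ∉ I := by decide)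
    (h15 : 15 ∉ I := by decide) (h5 : 5 ∉ R := by decide) (h6 : 6 ∉ R := by decide) :
    Tested p a b k ε C s' := by
  obtain ⟨hs, ht⟩ := h
  refine ⟨fun h => ?_, fun t hC => ?_⟩
  · rw [hf.1 15 h15] at h
    exact (hs h).frame hf h1 h2 h5 h6
  · rw [hf.1 15 h15, hf.2 6 h6]
    exact ht t hC

theorem runs_save (hs : HoldsInput a b k ε s) {M : Finset (Plane × Plane)}
    (hE : Encodes a b k (fun l => (s.int 12 l, s.int 13 l)) M)
    (hM : IsKMatching (pointSet a) (pointSet b) k M)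
    (hcost : s.real 9 0 = matchCost p M !₂[s.real 13 0, s.real 13 1]) :
    Runs O save s fun s' T => T ≤ 40 * k + 40 ∧
      (Frame [1, 2, 14, 15] [5, 6] s s' ∧ s'.int 15 0 = 1 ∧ s'.real 6 0 = s.real 9 0 ∧
        Saved p a b k s') := by
  simp only [save, runs_seq, runs_setInt, runs_setReal, IExp.eval, RExp.eval, IExp.size, RExp.size]
  simp only [ne_eq, Nat.reduceEqDiff, not_false_eq_true, writeReal_real_of_ne]
  set s₁ := ((((s.writeReal 6 0 (s.real 9 0)).writeReal 5 0 (s.real 13 0)).writeReal 5 1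
    (s.real 13 1)).writeInt 15 0 1).writeInt 14 0 0 with hs₁
  have fr₁ : Frame [1, 2, 14, 15] [5, 6] s s₁ := by
    refine (((((Frame.refl s).writeReal _ _ ?_).writeReal _ _ ?_).writeReal _ _ ?_).writeInt _ _
      ?_).writeInt _ _ ?_ <;> simp
  refine (runs_while k 25 (fun u s' => Frame [1, 2, 14] [] s₁ s' ∧ s'.int 14 0 = u ∧
    ∀ l < u, s'.int 1 l = s.int 12 l ∧ s'.int 2 l = s.int 13 l) ?_ ?_ ?_).mono ?_
  · rintro u s₂ hu ⟨fr, h0, hdone⟩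
    have hi := (hs.frame fr₁).frame fr
    refine ⟨by simp [h0, hi.int_k, hu], ?_⟩
    simp only [runs_seq, runs_setInt, IExp.eval, IExp.size]
    refine ⟨by simp, ?_, by simp [h0], ?_⟩
    · refine ((fr.writeInt _ _ ?_).writeInt _ _ ?_).writeInt _ _ ?_ <;> simp
    · intro l hl
      by_cases hlu : l = u
      · simp [h0, hlu, fr.int 12, fr.int 13, fr₁.int 12, fr₁.int 13]
      · simpa [h0, hlu] using hdone l (by omega)
  · rintro s₂ ⟨fr, h0, -⟩
    simp [h0, ((hs.frame fr₁).frame fr).int_k]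
  · exact ⟨Frame.refl s₁, by simp [hs₁], fun l hl => absurd hl (by omega)⟩
  · rintro s₂ T ⟨hT, fr, -, hdone⟩
    simp only [Test.size, IExp.size] at hT
    have h6 : s₂.real 6 0 = s.real 9 0 := by rw [fr.real 6]; simp [hs₁]
    refine ⟨by omega, fr₁.trans (fr.mono (by simp) (by simp)), ?_, h6, M, ?_, hM, ?_⟩
    · rw [fr.int 15]; simp [hs₁]
    · obtain ⟨i, j, hij, h⟩ := hE
      refine ⟨i, j, fun l => ?_, h⟩
      rw [← hij l, State.outPairs, (hdone l l.2).1, (hdone l l.2).2]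
    · rw [h6, hcost, State.outVector, fr.real 5]
      simp [hs₁]

theorem runs_tryTranslation (hs : HoldsInput a b k ε s) (ha : Function.Injective a)
    (hb : Function.Injective b) (hk : 1 ≤ k) (hmn : k ≤ min m n) (hε : 0 < ε) (hε1 : ε ≤ 1)
    {C : Set Plane} (hC : Tested p a b k ε C s) :
    Runs O (tryTranslation p) s fun s' T => T ≤ 500 * O.W m n k (ε / 2) ∧
      (Frame [1, 2, 12, 13, 14, 15] [5, 6, 7, 8, 9] s s' ∧
        Tested p a b k ε (insert !₂[s.real 13 0, s.real 13 1] C) s') := by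
  have hkm : k ≤ m := hmn.trans (min_le_left _ _)
  have hW : m + n ≤ O.W m n k (ε / 2) := Nat.le_add_right _ _
  have hkn : k ≤ n := hmn.trans (min_le_right _ _)
  refine Runs.of_le (B := (40 * m + 20) + ((20 + O.W m n k (ε / 2)) + ((170 * k + 40) +
    (40 * k + 60)))) ?_ (by omega)
  refine Runs.seq (runs_translatePoints hs) ?_
  rintro s₁ ⟨fr₁, h7⟩
  set t : Plane := !₂[s.real 13 0, s.real 13 1] with ht
  have hi₁ := hs.frame fr₁
  have hpA : s₁.points 7 8 m = fun i => a i + t := by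
    funext i
    rw [State.points, (h7 i).1, (h7 i).2]
    ext c
    fin_cases c <;> simp [ht]
  have hpB : s₁.points 2 3 n = b := by
    funext j
    rw [State.points, hi₁.real_b0, hi₁.real_b1]
    ext c
    fin_cases c <;> simp
  obtain ⟨M, hE, hM, hopt⟩ := O.exists_isKMatching_translate ha hb hk hmn
    (show 0 < ε / 2 by linarith) (by linarith) t
  have hsolve : O.solve (s₁.points 7 8 (s₁.int 0 0)) (s₁.points 2 3 (s₁.int 0 1)) k (ε / 2) =
      O.solve (fun i => a i + t) b k (ε / 2) := by
    rw [← hpA, ← hpB, hi₁.int_m, hi₁.int_n]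
  refine Runs.seq (R := fun s' => Frame [12, 13] [] s₁ s' ∧
    Encodes a b k (fun l => (s'.int 12 l, s'.int 13 l)) M) ?_ ?_
  · rw [queryMatching, runs_query]
    simp only [IExp.eval, RExp.eval, hi₁.int_k, hi₁.real_eps, Rat.cast_ofNat,
      hsolve, hi₁.int_m, hi₁.int_n, IExp.size, RExp.size]
    refine ⟨by omega, ⟨fun r hr => writePairs_int_of_ne _ _ _ ?_ ?_, fun r _ => rfl⟩, ?_⟩
    · exact fun h => hr (by simp [h])
    · exact fun h => hr (by simp [h])
    · obtain ⟨i, j, hij, h⟩ := hE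
      refine ⟨i, j, fun l => ?_, h⟩
      rw [← hij l]
      simp [State.writePairs]
  rintro s₂ ⟨fr₂, hE₂⟩
  have fr₂' : Frame [12, 13, 14] [7, 8] s s₂ :=
    (fr₁.mono (by simp) (by simp)).trans (fr₂.mono (by simp) (by simp))
  refine Runs.seq (runs_computeCost (hs.frame fr₂') (t := t) (M := M) ?_ hE₂ hM.2.1) ?_
  · intro i
    rw [fr₂.real 7, fr₂.real 8]
    simpa [ht] using h7 i
  rintro s₃ ⟨fr₃, h9⟩
  have fr₃' : Frame [12, 13, 14] [7, 8, 9] s s₃ :=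
    (fr₂'.mono (by simp) (by simp)).trans (fr₃.mono (by simp) (by simp))
  have hC₃ := hC.frame fr₃'
  rw [runs_ite]
  constructor
  · intro hbetter
    refine (runs_save (hs.frame fr₃') (M := M) ?_ hM ?_).mono ?_
    · simpa only [fr₃.int 12, fr₃.int 13] using hE₂
    · rw [fr₃'.real 13, h9]
    rintro s₄ T ⟨hT, fr₄, h15, h6, hsaved⟩
    refine ⟨?_, (fr₃'.mono (by simp) (by simp)).trans (fr₄.mono (by simp) (by simp)),
      fun _ => hsaved, ?_⟩
    · simp only [Test.size, IExp.size, RExp.size]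
      omega
    · rintro u (rfl | hu)
      · exact ⟨h15.ge, by rw [h6, h9]; exact hopt⟩
      · obtain ⟨h1, h2⟩ := hC₃.2 u hu
        refine ⟨h15.ge, le_trans ?_ h2⟩
        rw [h6]
        simp only [Test.Holds, IExp.eval, RExp.eval, not_and_or, not_not] at hbetter
        rcases hbetter with h | h
        · omega
        · exact h.le
  · intro hworse
    rw [runs_skip]
    simp only [Test.Holds, IExp.eval, RExp.eval, not_not, not_lt] at hworse
    refine ⟨?_, fr₃'.mono (by simp) (by simp), hC₃.1, ?_⟩
    · simp only [Test.size, IExp.size, RExp.size]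
      omega
    · rintro u (rfl | hu)
      · exact ⟨hworse.1, hworse.2.trans (h9 ▸ hopt)⟩
      · exact hC₃.2 u hu

end Try

/-! ### Sweeping over grids around the candidates -/

/-- The grid translation with indices `i`, `j` around the candidate `z`, for an estimate `ρ` of the
cost: the grid has mesh width `ε ρ / 72` and covers the square with centre `z` and half side
`2 ρ`. -/
noncomputable def gridPoint (ε ρ : ℝ) (z : ℝ × ℝ) (i j : ℕ) : Plane :=
  !₂[z.1 + (i * ε / 72 - 2) * ρ, z.2 + (j * ε / 72 - 2) * ρ]

/-- A coordinate of a grid translation: the coordinate of the candidate is stored in the array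
`arr`, and its index in the integer array `idx`. -/
def gridExp (arr idx : ℕ) : RExp :=
  .add (.read arr (iv 16 0))
    (.mul (.sub (.div (.mul (.ofInt (iv idx 0)) (rv 4 0)) (.const 72)) (.const 2)) (rv 12 0))

/-- The test whether the index in the integer array `idx` is in the range of the grid. -/
def gridTest (idx : ℕ) : Test :=
  .neg (.ltReal (.const 288) (.mul (.ofInt (iv idx 0)) (rv 4 0)))

/-- Try all grid translations around all candidates. The estimate of the cost is stored in the real
array `12`. -/
noncomputable def sweep (p : ℝ≥0∞) : Program :=
  .seq (setI 16 0 (.const 0))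
    (.while (.ltInt (iv 16 0) (.add (iv 7 0) (iv 4 0)))
      (.seq (setI 17 0 (.const 0))
        (.seq
          (.while (gridTest 17)
            (.seq (setI 18 0 (.const 0))
              (.seq
                (.while (gridTest 18)
                  (.seq (setR 13 0 (gridExp 10 17))
                    (.seq (setR 13 1 (gridExp 11 18))
                      (.seq (tryTranslation p) (incr 18 0)))))
                (incr 17 0))))
          (setI 16 0 (.add (iv 16 0) (iv 6 0))))))

section Sweep

variable {p : ℝ≥0∞} {O : StationarySolver p} {m n : ℕ} {a : Fin m → Plane} {b : Fin n → Plane}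
  {k : ℕ} {ε : ℝ} {s : State}

theorem Tested.anti {C C' : Set Plane} (h : Tested p a b k ε C s) (hC : C' ⊆ C) :
    Tested p a b k ε C' s :=
  ⟨h.1, fun t ht => h.2 t (hC ht)⟩

theorem holds_gridTest (hs : HoldsInput a b k ε s) (hε : 0 < ε) (idx : ℕ) :
    (gridTest idx).Holds p s ↔ s.int idx 0 < ⌊288 / ε⌋₊ + 1 := by
  rw [Nat.lt_add_one_iff, Nat.le_floor_iff (by positivity), le_div_iff₀ hε]
  simp [gridTest, hs.real_eps]

theorem runs_sweep (hs : HoldsInput a b k ε s) (ha : Function.Injective a)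
    (hb : Function.Injective b) (hk : 1 ≤ k) (hmn : k ≤ min m n) (hε : 0 < ε) (hε1 : ε ≤ 1)
    {total σ G : ℕ} (htot : s.int 7 0 + s.int 4 0 = total) (h6 : s.int 6 0 = σ) (hσ : 1 ≤ σ)
    (hG : G = ⌊288 / ε⌋₊ + 1) {ρ : ℝ} (hρ : s.real 12 0 = ρ)
    {C : Set Plane} (hC : Tested p a b k ε C s) :
    Runs O (sweep p) s fun s' T => T ≤ (total / σ + 1) * (600 * (G * (G * O.W m n k (ε / 2)))) +
        20 ∧
      (Frame [1, 2, 12, 13, 14, 15, 16, 17, 18] [5, 6, 7, 8, 9, 13] s s' ∧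
        Tested p a b k ε (C ∪ {t | ∃ q i j, q < total ∧ σ ∣ q ∧ i < G ∧ j < G ∧
          t = gridPoint ε ρ (pts s q) i j}) s') := by
  set W := O.W m n k (ε / 2) with hW
  have hW2 : 2 ≤ W := by
    have : m + n ≤ W := Nat.le_add_right _ _
    have := hmn.trans (min_le_left _ _)
    have := hmn.trans (min_le_right _ _)
    omega
  have hG1 : 1 ≤ G := by omega
  have hGW : G * 2 ≤ G * W := Nat.mul_le_mul_left _ hW2
  have hGGW : G * (G * 2) ≤ G * (G * W) := Nat.mul_le_mul_left _ hGW
  have hGG : G * 1 ≤ G * (G * 2) := Nat.mul_le_mul_left _ (by omega)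
  simp only [sweep, runs_seq, runs_setInt, IExp.eval, IExp.size]
  -- the number of candidates
  set Q := (total + σ - 1) / σ with hQ
  have hQlt : ∀ t, t < Q ↔ t * σ < total := fun t => by
    rw [hQ, ← Nat.succ_le_iff, Nat.le_div_iff_mul_le hσ, Nat.succ_mul]
    omega
  have hQle : Q ≤ total / σ + 1 := by
    rw [hQ, ← Nat.add_div_right _ hσ]
    exact Nat.div_le_div_right (by omega)
  refine (runs_while Q (590 * (G * (G * W)))
    (fun t s' => Frame [1, 2, 12, 13, 14, 15, 16, 17, 18] [5, 6, 7, 8, 9, 13] s s' ∧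
      s'.int 16 0 = t * σ ∧
      Tested p a b k ε (C ∪ {x | ∃ u i j, u < t ∧ i < G ∧ j < G ∧
        x = gridPoint ε ρ (pts s (u * σ)) i j}) s') ?_ ?_ ?_).mono ?_
  · rintro t s₁ ht ⟨fr, h16, hC₁⟩
    set C₁ := C ∪ {x | ∃ u i j, u < t ∧ i < G ∧ j < G ∧
        x = gridPoint ε ρ (pts s (u * σ)) i j}
    constructor
    · simp only [Test.Holds, IExp.eval, h16, fr.int 7, fr.int 4, htot]
      exact (hQlt t).1 ht
    simp only [runs_seq, runs_setInt, IExp.eval, IExp.size]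
    refine (runs_while G (560 * (G * W))
      (fun i s' => Frame [1, 2, 12, 13, 14, 15, 16, 17, 18] [5, 6, 7, 8, 9, 13] s s' ∧
        s'.int 16 0 = t * σ ∧ s'.int 17 0 = i ∧
        Tested p a b k ε (C₁ ∪ {x | ∃ i' j, i' < i ∧ j < G ∧
          x = gridPoint ε ρ (pts s (t * σ)) i' j}) s') ?_ ?_ ?_).mono ?_
    · rintro i s₂ hi ⟨fr, h16, h17, hC₂⟩
      set C₂ := C₁ ∪ {x | ∃ i' j, i' < i ∧ j < G ∧ x = gridPoint ε ρ (pts s (t * σ)) i' j}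
      refine ⟨(holds_gridTest (hs.frame fr) hε 17).2 (by omega), ?_⟩
      simp only [runs_seq, runs_setInt, IExp.eval, IExp.size]
      refine (runs_while G (530 * W)
        (fun j s' => Frame [1, 2, 12, 13, 14, 15, 16, 17, 18] [5, 6, 7, 8, 9, 13] s s' ∧
          s'.int 16 0 = t * σ ∧ s'.int 17 0 = i ∧ s'.int 18 0 = j ∧
          Tested p a b k ε (C₂ ∪ {x | ∃ j' < j,
            x = gridPoint ε ρ (pts s (t * σ)) i j'}) s') ?_ ?_ ?_).mono ?_
      · rintro j s₃ hj ⟨fr, h16, h17, h18, hC₃⟩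
        refine ⟨(holds_gridTest (hs.frame fr) hε 18).2 (by omega), ?_⟩
        simp only [runs_seq, runs_setInt, runs_setReal, IExp.eval, IExp.size]
        set s₄ := (s₃.writeReal 13 0 ((gridExp 10 17).eval p s₃)).writeReal 13 1
          ((gridExp 11 18).eval p (s₃.writeReal 13 0 ((gridExp 10 17).eval p s₃))) with hs₄
        have fr₄ : Frame [] [13] s₃ s₄ :=
          ((Frame.refl s₃).writeReal _ _ (by simp)).writeReal _ _ (by simp)
        have fr' := fr.trans (fr₄.mono (by simp) (by simp))
        have hpt : !₂[s₄.real 13 0, s₄.real 13 1] = gridPoint ε ρ (pts s (t * σ)) i j := by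
          have e0 : s₄.real 13 0 = (pts s (t * σ)).1 + (i * ε / 72 - 2) * ρ := by
            simp [hs₄, gridExp, pts, h16, h17, fr.real 10, fr.real 12, hρ,
              (hs.frame fr).real_eps]
          have e1 : s₄.real 13 1 = (pts s (t * σ)).2 + (j * ε / 72 - 2) * ρ := by
            simp [hs₄, gridExp, pts, h16, h18, fr.real 11, fr.real 12, hρ,
              (hs.frame fr).real_eps]
          rw [e0, e1, gridPoint]
        refine (runs_tryTranslation (hs.frame fr') ha hb hk hmn hε hε1
          (hC₃.frame fr₄)).mono ?_
        rintro s₅ T ⟨hT, fr₅, hC₅⟩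
        rw [hpt] at hC₅
        refine ⟨?_, (fr'.trans (fr₅.mono (by simp) (by simp))).writeInt _ _ (by simp), ?_, ?_, ?_,
          ?_⟩
        · simp only [gridExp, RExp.size, IExp.size]
          omega
        · simp [fr₅.int 16, fr₄.int 16, h16]
        · simp [fr₅.int 17, fr₄.int 17, h17]
        · simp [fr₅.int 18, fr₄.int 18, h18]
        · refine Tested.frame (Tested.anti hC₅ ?_)
            ((Frame.refl (I := [18]) (R := []) s₅).writeInt _ _ (by simp))
          rintro x (hx | ⟨j', hj', rfl⟩)
          · exact Or.inr (Or.inl hx)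
          · rcases Nat.lt_succ_iff_lt_or_eq.1 hj' with h | rfl
            · exact Or.inr (Or.inr ⟨j', h, rfl⟩)
            · exact Or.inl rfl
      · rintro s₃ ⟨fr, -, -, h18, -⟩
        rw [holds_gridTest (hs.frame fr) hε]
        omega
      · refine ⟨fr.writeInt _ _ (by simp), by simp [h16], by simp [h17], by simp,
          Tested.frame (Tested.anti hC₂ ?_)
            ((Frame.refl (I := [18]) (R := []) s₂).writeInt _ _ (by simp))⟩
        rintro x (hx | ⟨j', hj', -⟩)
        · exact hx
        · omega
      · rintro s₃ T ⟨hT, fr, h16, h17, -, hC₃⟩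
        refine ⟨?_, fr.writeInt _ _ (by simp), by simp [h16], by simp [h17],
          Tested.frame (Tested.anti hC₃ ?_)
            ((Frame.refl (I := [17]) (R := []) s₃).writeInt _ _ (by simp))⟩
        · simp only [gridTest, Test.size, IExp.size, RExp.size, Nat.mul_add,
            Nat.mul_left_comm G] at hT
          omega
        · rintro x (hx | ⟨i', j', hi', hj', rfl⟩)
          · exact Or.inl (Or.inl hx)
          · rcases Nat.lt_succ_iff_lt_or_eq.1 hi' with h | rfl
            · exact Or.inl (Or.inr ⟨i', j', h, hj', rfl⟩)
            · exact Or.inr ⟨j', hj', rfl⟩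
    · rintro s₂ ⟨fr, -, h17, -⟩
      rw [holds_gridTest (hs.frame fr) hε]
      omega
    · refine ⟨fr.writeInt _ _ (by simp), by simp [h16], by simp,
        Tested.frame (Tested.anti hC₁ ?_)
          ((Frame.refl (I := [17]) (R := []) s₁).writeInt _ _ (by simp))⟩
      rintro x (hx | ⟨i', j', hi', -⟩)
      · exact hx
      · omega
    · rintro s₂ T ⟨hT, fr, h16, -, hC₂⟩
      refine ⟨?_, fr.writeInt _ _ (by simp), ?_,
        Tested.frame (Tested.anti hC₂ ?_)
          ((Frame.refl (I := [16]) (R := []) s₂).writeInt _ _ (by simp))⟩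
      · simp only [gridTest, Test.size, IExp.size, RExp.size, Nat.mul_add,
            Nat.mul_left_comm G] at hT
        omega
      · simp [h16, fr.int 6, h6]; ring
      · rintro x (hx | ⟨u, i', j', hu, hi', hj', rfl⟩)
        · exact Or.inl (Or.inl hx)
        · rcases Nat.lt_succ_iff_lt_or_eq.1 hu with h | rfl
          · exact Or.inl (Or.inr ⟨u, i', j', h, hi', hj', rfl⟩)
          · exact Or.inr ⟨i', j', hi', hj', rfl⟩
  · rintro s₁ ⟨fr, h16, -⟩
    simp only [Test.Holds, IExp.eval, h16, fr.int 7, fr.int 4, htot]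
    exact fun h => lt_irrefl _ ((hQlt Q).2 h)
  · refine ⟨(Frame.refl s).writeInt _ _ (by simp), by simp,
      Tested.frame (Tested.anti hC ?_)
        ((Frame.refl (I := [16]) (R := []) s).writeInt _ _ (by simp))⟩
    rintro x (hx | ⟨u, i', j', hu, -⟩)
    · exact hx
    · omega
  · rintro s₁ T ⟨hT, fr, -, hC₁⟩
    refine ⟨?_, fr, hC₁.anti ?_⟩
    · simp only [Test.size, IExp.size] at hT
      have h1 : Q * (1 + 1 + (1 + 1 + (1 + 1) + 1) + 1 + 590 * (G * (G * W))) ≤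
          (total / σ + 1) * (600 * (G * (G * W))) :=
        Nat.mul_le_mul hQle (by omega)
      omega
    · rintro x (hx | ⟨q, i, j, hq, ⟨u, rfl⟩, hi, hj, rfl⟩)
      · exact Or.inl hx
      · rw [mul_comm] at hq ⊢
        exact Or.inr ⟨u, i, j, (hQlt u).2 hq, hi, hj, rfl⟩

end Sweep

/-! ### The approximation guarantee -/

section Guarantee

variable {p : ℝ≥0∞} {m n : ℕ} {a : Fin m → Plane} {b : Fin n → Plane} {k : ℕ} {ε : ℝ}

theorem norm_le_abs_add_abs (x : Plane) : ‖x‖ ≤ |x 0| + |x 1| := by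
  rw [norm_eq_sqrt]
  refine Real.sqrt_le_iff.2 ⟨by positivity, ?_⟩
  nlinarith [abs_nonneg (x 0), abs_nonneg (x 1), abs_mul_abs_self (x 0), abs_mul_abs_self (x 1),
    mul_nonneg (abs_nonneg (x 0)) (abs_nonneg (x 1))]

/-- At least half of the edges of an optimal matching have difference vectors in a small square
around the translation. -/
theorem exists_short_pairs (hp : 1 ≤ p) (ha : Function.Injective a) (hb : Function.Injective b)
    (hkm : k ≤ m) (hkn : k ≤ n) (t : Plane) :
    ∃ F : Finset (Fin m × Fin n), k ≤ 2 * F.card ∧ ∀ e ∈ F, ∀ c : Fin 2,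
      |b e.2 c - a e.1 c - t c| ≤ 2 * optCost p (pointSet a) (pointSet b) k t := by
  classical
  obtain ⟨M, hM, hcost⟩ := exists_matchCost_eq_optCost (A := pointSet a) (B := pointSet b) (k := k)
    p (by rwa [card_pointSet ha]) (by rwa [card_pointSet hb]) t
  rw [← hcost]
  refine ⟨Finset.univ.filter fun e => ‖a e.1 + t - b e.2‖ ≤ 2 * matchCost p M t ∧
    (a e.1, b e.2) ∈ M, ?_, ?_⟩
  · have h := card_le_two_mul_card_short hp M t
    rw [hM.2.1] at h
    refine h.trans (Nat.mul_le_mul_left 2 ?_)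
    refine le_trans (Finset.card_le_card fun e he => ?_)
      (Finset.card_image_le (f := fun e : Fin m × Fin n => (a e.1, b e.2)))
    obtain ⟨heM, he⟩ := Finset.mem_filter.1 he
    obtain ⟨h1, h2⟩ := Finset.mem_product.1 (hM.1 heM)
    obtain ⟨i, hi⟩ := mem_pointSet.1 h1
    obtain ⟨j, hj⟩ := mem_pointSet.1 h2
    refine Finset.mem_image.2 ⟨(i, j), Finset.mem_filter.2 ⟨Finset.mem_univ _, ?_⟩, ?_⟩
    · simp only [hi, hj]
      exact ⟨he, heM⟩
    · simp only [hi, hj]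
  · intro e he c
    refine le_trans ?_ (Finset.mem_filter.1 he).2.1
    have := PiLp.norm_apply_le (a e.1 + t - b e.2) c
    rw [Real.norm_eq_abs] at this
    rw [abs_sub_comm]
    refine (le_of_eq ?_).trans this
    congr 1
    simp
    ring

/-- The grid of mesh width `ε ρ / 72` in one dimension. -/
theorem exists_grid_near {ε ρ z x : ℝ} (hε : 0 < ε) (hρ : 0 ≤ ρ) (h : |z - x| ≤ 2 * ρ) :
    ∃ i < ⌊288 / ε⌋₊ + 1, |z + ((i : ℕ) * ε / 72 - 2) * ρ - x| ≤ ε * ρ / 72 := by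
  obtain ⟨h1, h2⟩ := abs_le.1 h
  rcases hρ.eq_or_lt with rfl | hρ
  · refine ⟨0, Nat.succ_pos _, ?_⟩
    simpa using h
  · have hw : 0 < ε * ρ / 72 := by positivity
    have hnn : 0 ≤ (x - z + 2 * ρ) / (ε * ρ / 72) := div_nonneg (by linarith) hw.le
    have e1 : (x - z + 2 * ρ) / (ε * ρ / 72) * (ε * ρ / 72) = x - z + 2 * ρ :=
      div_mul_cancel₀ _ hw.ne'
    refine ⟨⌊(x - z + 2 * ρ) / (ε * ρ / 72)⌋₊, Nat.lt_succ_of_le (Nat.floor_le_floor ?_), ?_⟩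
    · rw [div_le_div_iff₀ hw hε]
      nlinarith
    · have f1 := mul_le_mul_of_nonneg_right (Nat.floor_le hnn) hw.le
      have f2 := mul_lt_mul_of_pos_right (Nat.lt_floor_add_one ((x - z + 2 * ρ) / (ε * ρ / 72))) hw
      rw [e1] at f1 f2
      set i : ℝ := (⌊(x - z + 2 * ρ) / (ε * ρ / 72)⌋₊ : ℝ)
      have e2 : (i * ε / 72 - 2) * ρ = i * (ε * ρ / 72) - 2 * ρ := by ring
      rw [e2, abs_le]
      constructor <;> linarith

theorem optCost_le_of_abs_sub_le (hp : 1 ≤ p) (ha : Function.Injective a) (hb : Function.Injective b)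
    (hkm : k ≤ m) (hkn : k ≤ n) {t u : Plane} {δ : ℝ}
    (h : ∀ c, |u c - t c| ≤ δ) :
    optCost p (pointSet a) (pointSet b) k u ≤
      optCost p (pointSet a) (pointSet b) k t + 2 * δ := by
  refine (optCost_le_add hp (by rwa [card_pointSet ha]) (by rwa [card_pointSet hb]) t u).trans ?_
  have h1 := norm_le_abs_add_abs (u - t)
  have h2 := h 0
  have h3 := h 1
  simp only [PiLp.sub_apply] at h1
  linarith

end Guarantee

/-! ### The running time -/

theorem two_pow_clog_le {N : ℕ} (hN : 1 ≤ N) : 2 ^ Nat.clog 2 N ≤ 2 * N := by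
  rcases hN.eq_or_lt with rfl | h
  · simp
  · have h1 := Nat.pow_pred_clog_lt_self (b := 2) (by norm_num) h
    have h2 : 0 < Nat.clog 2 N := Nat.clog_pos (by norm_num) h
    obtain ⟨L, hL⟩ : ∃ L, Nat.clog 2 N = L + 1 := ⟨Nat.clog 2 N - 1, by omega⟩
    rw [hL] at h1 ⊢
    rw [pow_succ]
    simp only [Nat.pred_succ] at h1
    omega

theorem clog_le_log {N : ℕ} (hN : 1 ≤ N) {x : ℝ} (hx : (N : ℝ) ≤ x) :
    (Nat.clog 2 N : ℝ) ≤ 2 * (1 + Real.log x) := by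
  have hN0 : (0 : ℝ) < N := by exact_mod_cast hN
  have h1 : ((2 : ℝ) ^ Nat.clog 2 N) ≤ 2 * N := by exact_mod_cast two_pow_clog_le hN
  have h2 := Real.log_le_log (by positivity) h1
  rw [Real.log_pow, Real.log_mul (by norm_num) hN0.ne'] at h2
  have h3 := Real.log_le_log hN0 hx
  have h4 : 0 ≤ Real.log N := Real.log_nonneg (by exact_mod_cast hN)
  have h5 : 0.6931471803 < Real.log 2 := Real.log_two_gt_d9
  have h6 : Real.log 2 < 0.6931471808 := Real.log_two_lt_d9
  have h7 : (0 : ℝ) ≤ Nat.clog 2 N := Nat.cast_nonneg _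
  nlinarith

/-- The number of candidates is `O(m n / k)` up to the square of a logarithm, since the stride `σ` is
at least `k / (4 L + 2)`; every one of the `O(1 / ε ^ 2)` translations around a candidate costs time
`O(W)`. -/
theorem time_le {m n k L σ W T : ℕ} {ε : ℝ} (hk : 1 ≤ k) (hkmn : k ≤ m * n)
    (hL : L = Nat.clog 2 (m * n)) (hσ : 1 ≤ σ) (hkσ : k ≤ (4 * L + 2) * σ) (hε : 0 < ε)
    (hε1 : ε ≤ 1)
    (hT : T ≤ 125 * (m * n) + 2 * ((L + 1) * (200 * 2 ^ L + 100)) + 25 * L + 60 +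
      (2 * (((2 * L + 1) * 2 ^ L / σ + 1) *
        (600 * ((⌊288 / ε⌋₊ + 1) * ((⌊288 / ε⌋₊ + 1) * W)))) + 50)) :
    (T : ℝ) ≤ 20000000000 * ((m : ℝ) * n + (m : ℝ) * n / (ε ^ 2 * k) * W) *
      (1 + Real.log ((m : ℝ) * n / ε)) ^ 2 := by
  have hmn : 1 ≤ m * n := hk.trans hkmn
  set N : ℝ := (m : ℝ) * n with hN
  have hN1 : (1 : ℝ) ≤ N := by rw [hN]; exact_mod_cast hmn
  have hNε : N ≤ N / ε := by rw [le_div_iff₀ hε]; nlinarith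
  set Λ : ℝ := 1 + Real.log (N / ε) with hΛ
  have hΛ1 : 1 ≤ Λ := by
    have := Real.log_nonneg (hN1.trans hNε)
    linarith
  have hLΛ : (L : ℝ) ≤ 2 * Λ := by
    rw [hL]; exact clog_le_log hmn (by rw [Nat.cast_mul]; exact hNε)
  have hpow : (2 : ℝ) ^ L ≤ 2 * N := by
    rw [hL, hN]; exact_mod_cast two_pow_clog_le hmn
  have hk0 : (0 : ℝ) < k := by exact_mod_cast hk
  have hσ0 : (0 : ℝ) < σ := by exact_mod_cast hσ
  have hkN : 1 ≤ N / k := by rw [le_div_iff₀ hk0, one_mul, hN]; exact_mod_cast hkmn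
  have hG : ((⌊288 / ε⌋₊ + 1 : ℕ) : ℝ) ≤ 289 / ε := by
    push_cast
    have h1 := Nat.floor_le (show 0 ≤ 288 / ε by positivity)
    have h2 : 1 ≤ 1 / ε := by rw [le_div_iff₀ hε]; linarith
    have : 289 / ε = 288 / ε + 1 / ε := by ring
    linarith
  have hL0 : (0 : ℝ) ≤ L := Nat.cast_nonneg L
  have hcand : (((2 * L + 1) * 2 ^ L / σ + 1 : ℕ) : ℝ) ≤ 101 * Λ ^ 2 * (N / k) := by
    push_cast
    have h1 : (((2 * L + 1) * 2 ^ L / σ : ℕ) : ℝ) ≤ (2 * L + 1) * 2 ^ L / σ := by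
      refine Nat.cast_div_le.trans_eq ?_
      push_cast
      ring
    have h2 : 1 / (σ : ℝ) ≤ (4 * L + 2) / k := by
      rw [div_le_div_iff₀ hσ0 hk0, one_mul]; exact_mod_cast hkσ
    have h3 : (2 * (L : ℝ) + 1) * 2 ^ L / σ ≤ 100 * Λ ^ 2 * (N / k) := by
      calc (2 * (L : ℝ) + 1) * 2 ^ L / σ = (2 * L + 1) * 2 ^ L * (1 / σ) := by ring
        _ ≤ (5 * Λ) * (2 * N) * ((10 * Λ) / k) := by
            refine mul_le_mul (mul_le_mul (by linarith) hpow (by positivity) (by linarith))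
              (h2.trans ?_) (by positivity) (by positivity)
            gcongr
            linarith
        _ = 100 * Λ ^ 2 * (N / k) := by ring
    have h4 : 1 ≤ Λ ^ 2 * (N / k) := one_le_mul_of_one_le_of_one_le (one_le_pow₀ hΛ1) hkN
    linarith
  have hsweep : (((2 * L + 1) * 2 ^ L / σ + 1 : ℕ) : ℝ) *
      (600 * (((⌊288 / ε⌋₊ + 1 : ℕ) : ℝ) * (((⌊288 / ε⌋₊ + 1 : ℕ) : ℝ) * W))) ≤
      (101 * 600 * 289 ^ 2) * (N / (ε ^ 2 * k) * W) * Λ ^ 2 := by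
    calc _ ≤ (101 * Λ ^ 2 * (N / k)) * (600 * ((289 / ε) * ((289 / ε) * W))) := by
          gcongr
      _ = _ := by field_simp
  have hT' : (T : ℝ) ≤ 125 * N + 2 * ((L + 1) * (200 * 2 ^ L + 100)) + 25 * L + 60 +
      (2 * ((((2 * L + 1) * 2 ^ L / σ + 1 : ℕ) : ℝ) *
        (600 * (((⌊288 / ε⌋₊ + 1 : ℕ) : ℝ) * (((⌊288 / ε⌋₊ + 1 : ℕ) : ℝ) * W)))) + 50) := by
    rw [hN]
    exact_mod_cast hT
  have hsort : ((L : ℝ) + 1) * (200 * 2 ^ L + 100) ≤ (3 * Λ) * (500 * N) :=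
    mul_le_mul (by linarith) (by linarith) (by positivity) (by positivity)
  have hΛ2 : Λ ≤ Λ ^ 2 := by nlinarith
  have hNΛ : N * Λ ≤ N * Λ ^ 2 := mul_le_mul_of_nonneg_left hΛ2 (by linarith)
  have hN2 : N ≤ N * Λ := le_mul_of_one_le_right (by linarith) hΛ1
  have hΛN : Λ ≤ N * Λ := le_mul_of_one_le_left (by linarith) hN1
  have hX : 0 ≤ N / (ε ^ 2 * k) * W * Λ ^ 2 := by positivity
  nlinarith

/-- The approximation algorithm. The first sweep, with the estimate `0`, evaluates only the
candidates themselves; its result is the estimate of the cost for the second sweep. -/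
noncomputable def approxProgram (p : ℝ≥0∞) : Program :=
  .seq prepare (.seq (sweep p) (.seq (setR 12 0 (rv 6 0)) (sweep p)))

end RealRAM

open RealRAM in
theorem mainTheorem1 (p : ℝ≥0∞) (hp : 1 ≤ p) :
    ∃ (P : RealRAM.Program) (C : ℝ) (c : ℕ),
      ∀ (O : StationarySolver p) (m n k : ℕ) (ε : ℝ) (a : Fin m → Plane) (b : Fin n → Plane),
        Function.Injective a → Function.Injective b → 1 ≤ k → k ≤ min m n → 0 < ε → ε ≤ 1 →
        ∃ (s : RealRAM.State) (T : ℕ) (M : Finset (Plane × Plane)) (tStar : Plane),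
          RealRAM.Exec O P (RealRAM.input a b k ε) s T ∧
          (T : ℝ) ≤ C * ((m : ℝ) * n + (m : ℝ) * n / (ε ^ 2 * k) * O.W m n k (ε / 2)) *
            (1 + Real.log ((m : ℝ) * n / ε)) ^ c ∧
          Encodes a b k s.outPairs M ∧
          IsKMatching (pointSet a) (pointSet b) k M ∧
          (∀ t : Plane, optCost p (pointSet a) (pointSet b) k tStar ≤
            optCost p (pointSet a) (pointSet b) k t) ∧
          matchCost p M s.outVector ≤ (1 + ε) * optCost p (pointSet a) (pointSet b) k tStar := by
  -- the constant exceeds twice the factor `101 * 600 * 289 ^ 2` of a single sweep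
  refine ⟨approxProgram p, 20000000000, 2, ?_⟩
  intro O m n k ε a b ha hb hk hmn hε hε1
  obtain ⟨hkm, hkn⟩ := le_min_iff.1 hmn
  obtain ⟨t, ht⟩ := exists_forall_optCost_le (A := pointSet a) (B := pointSet b) hp hk
    (by rwa [card_pointSet ha]) (by rwa [card_pointSet hb])
  set r := optCost p (pointSet a) (pointSet b) k t with hr
  have hr0 : 0 ≤ r := optCost_nonneg _ _ _ _ _
  have hin : HoldsInput a b k ε (input a b k ε) := ⟨rfl, fun _ _ => rfl⟩
  suffices H : Runs O (approxProgram p) (input a b k ε) fun s T =>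
      (T : ℝ) ≤ 20000000000 * ((m : ℝ) * n + (m : ℝ) * n / (ε ^ 2 * k) * O.W m n k (ε / 2)) *
        (1 + Real.log ((m : ℝ) * n / ε)) ^ 2 ∧
      Saved p a b k s ∧ s.real 6 0 ≤ (1 + ε) * r by
    obtain ⟨s, T, hE, hT, ⟨M, hM, hM', hcost⟩, hle⟩ := H
    exact ⟨s, T, M, t, hE, hT, hM, hM', ht, hcost.trans_le hle⟩
  rw [approxProgram, runs_seq]
  refine (runs_prepare hin (by simp [input]) (by simp [input]) hk hkm (by omega) rfl).mono ?_
  rintro s₁ T₁ ⟨hT₁, fr₁, h4, h7, σ, h6, hσ, hkσ, hnet⟩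
  set L := Nat.clog 2 (m * n) with hL
  -- a candidate close to the optimal translation
  obtain ⟨F, hF, hbox⟩ := exists_short_pairs hp ha hb hkm hkn t
  obtain ⟨q, hq, hσq, ⟨hz1, hz2⟩, hz3, hz4⟩ := hnet F (t 0 - 2 * r) (t 0 + 2 * r)
    (t 1 - 2 * r) (t 1 + 2 * r) hF (by
      intro e he
      have h0 := abs_le.1 (hbox e he 0)
      have h1 := abs_le.1 (hbox e he 1)
      refine ⟨⟨?_, ?_⟩, ?_, ?_⟩ <;> linarith)
  set z := pts s₁ q with hz
  have htot : s₁.int 7 0 + s₁.int 4 0 = (2 * L + 1) * 2 ^ L := by rw [h4, h7]; ring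
  rw [runs_seq]
  refine (runs_sweep (hin.frame fr₁) ha hb hk hmn hε hε1 htot h6 hσ rfl
    (ρ := 0) (by rw [fr₁.real 12]; simp [input]) (C := ∅) ?_).mono ?_
  · refine ⟨fun h => ?_, fun t ht => absurd ht (Set.notMem_empty t)⟩
    rw [fr₁.int 15] at h
    simp [input] at h
  rintro s₂ T₂ ⟨hT₂, fr₂, hC₂⟩
  obtain ⟨hflag, hest⟩ := hC₂.2 !₂[z.1, z.2]
    (Or.inr ⟨q, 0, 0, hq, hσq, Nat.succ_pos _, Nat.succ_pos _, by simp [gridPoint, hz]⟩)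
  rw [runs_seq, runs_setReal]
  simp only [IExp.eval, RExp.eval, IExp.size, RExp.size]
  -- the cost `ρ` found by the first sweep estimates the optimal cost
  set ρ := s₂.real 6 0 with hρ
  have hrρ : r ≤ ρ := by
    obtain ⟨M, -, hM, hcost⟩ := hC₂.1 hflag
    rw [hρ, ← hcost]
    exact (ht _).trans (optCost_le hM _)
  have hρr : ρ ≤ 15 / 2 * r := by
    have h1 := optCost_le_of_abs_sub_le hp ha hb hkm hkn (t := t) (u := !₂[z.1, z.2]) (δ := 2 * r) (by
      intro c
      rw [abs_le]
      fin_cases c <;> constructor <;> simp <;> linarith)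
    refine hest.trans ?_
    calc _ ≤ (1 + ε / 2) * (r + 2 * (2 * r)) := mul_le_mul_of_nonneg_left h1 (by linarith)
      _ ≤ (3 / 2) * (r + 2 * (2 * r)) := mul_le_mul_of_nonneg_right (by linarith) (by linarith)
      _ = _ := by ring
  set s₃ := s₂.writeReal 12 0 ρ with hs₃
  have fr₃ : Frame [] [12] s₂ s₃ := (Frame.refl s₂).writeReal _ _ (by simp)
  have fr₂' := (fr₂.mono (I' := [1, 2, 3, 4, 5, 6, 7, 8, 9, 10, 11, 12, 13, 14, 15, 16, 17, 18])
    (R' := [5, 6, 7, 8, 9, 10, 11, 12, 13]) (by simp) (by simp)).trans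
    (fr₃.mono (by simp) (by simp))
  have hin₃ : HoldsInput a b k ε s₃ := (hin.frame fr₁).frame fr₂'
  refine (runs_sweep hin₃ ha hb hk hmn hε hε1 (total := (2 * L + 1) * 2 ^ L)
    (by rw [fr₃.int 7, fr₃.int 4, fr₂.int 7, fr₂.int 4]; exact htot)
    (by rw [fr₃.int 6, fr₂.int 6, h6]) hσ rfl (ρ := ρ) (by simp [hs₃])
    (hC₂.frame fr₃)).mono ?_
  rintro s₄ T₄ ⟨hT₄, -, hC₄⟩
  have hpts : pts s₃ q = z :=
    pts_eq_of_real (by rw [fr₃.real 10, fr₂.real 10]) (by rw [fr₃.real 11, fr₂.real 11])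
  obtain ⟨i, hi, hi'⟩ := exists_grid_near (z := z.1) (x := t 0) hε (hr0.trans hrρ)
    (abs_le.2 ⟨by linarith, by linarith⟩)
  obtain ⟨j, hj, hj'⟩ := exists_grid_near (z := z.2) (x := t 1) hε (hr0.trans hrρ)
    (abs_le.2 ⟨by linarith, by linarith⟩)
  obtain ⟨hflag₄, hcost₄⟩ := hC₄.2 (gridPoint ε ρ z i j)
    (Or.inr ⟨q, i, j, hq, hσq, hi, hj, by rw [hpts]⟩)
  refine ⟨?_, hC₄.1 hflag₄, ?_⟩
  · refine time_le hk (hkm.trans (Nat.le_mul_of_pos_right m (by omega))) hL hσ hkσ hε hε1 ?_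
    omega
  · have h1 := optCost_le_of_abs_sub_le hp ha hb hkm hkn (t := t) (u := gridPoint ε ρ z i j)
      (δ := ε * ρ / 72) (by
        intro c
        fin_cases c
        · exact hi'
        · exact hj')
    have h2 : 2 * (ε * ρ / 72) ≤ 5 / 24 * (ε * r) := by
      have := mul_le_mul_of_nonneg_left hρr hε.le
      linarith
    have h3 : 0 ≤ (ε * r) * (1 - ε) := mul_nonneg (mul_nonneg hε.le hr0) (by linarith)
    refine hcost₄.trans ?_
    calc _ ≤ (1 + ε / 2) * (r + 5 / 24 * (ε * r)) :=
          mul_le_mul_of_nonneg_left (by linarith) (by linarith)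
      _ ≤ (1 + ε) * r := by nlinarith [mul_nonneg hε.le hr0]
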